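/- Let $\mathcal H$ be a separable complex Hilbert space and let $X\subset\mathbb R^d$ be relatively separated, i.e. countable with $\sup_{x\in\mathbb R^d}|X\cap(x+[0,1]^d)|<\infty$. Let $\nu:\mathbb R^d\to(0,\infty)$ be an admissible weight: $\nu(x)=e^{\rho(\|x\|)}$ for some norm $\|\cdot\|$ on $\mathbb R^d$ and some continuous concave $\rho:[0,\infty)\to[0,\infty)$ with $\rho(0)=0$, and $\lim_{n\to\infty}\nu(nz)^{1/n}=1$ for all $z\in\mathbb R^d$. Assume that $\nu(x)\ge C(1+|x|)^{\delta}$ for all $x\in\mathbb R^d$, for some $\delta\in(0,1]$ and $C>0$, where $|\cdot|$ is the Euclidean norm, and let $\alpha\in\mathbb N_0^d$. Let $\mathcal A$ be the class of all $\mathcal B(\mathcal H)$-valued matrices $A=[A_{k,l}]_{k,l\in X}$ for which $$\|A\|_{\mathcal A}:=\max\Big\{\sup_{k\in X}\sum_{l\in X}\prod_{j=1}^d(1+|k_j-l_j|)^{\alpha_j}\|A_{k,l}\|\,\nu(k-l),\ \sup_{l\in X}\sum_{k\in X}\prod_{j=1}^d(1+|k_j-l_j|)^{\alpha_j}\|A_{k,l}\|\,\nu(k-l)\Big\}<\infty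 .$$ (1) With the entrywise linear operations, the matrix product $[AB]_{k,l}=\sum_{n\in X}A_{k,n}B_{n,l}$ (unconditionally convergent in operator norm), the unit $\mathrm{diag}[\mathcal I_{\mathcal B(\mathcal H)}]_{k\in X}$, the involution $[A^*]_{k,l}=(A_{l,k})^*$ and the norm $\|\cdot\|_{\mathcal A}$, the class $\mathcal A$ is a unital Banach $*$-algebra (in particular the norm is submultiplicative and complete, and the involution is isometric). (2) $\mathcal A$ is solid: if $A\in\mathcal A$ and $B$ is a $\mathcal B(\mathcal H)$-valued matrix with $\|B_{k,l}\|\le\|A_{k,l}\|$ for all $k,l\in X$, then $B\in\mathcal A$ and $\|B\|_{\mathcal A}\le\|A\|_{\mathcal A}$. (3) The norm $\|\cdot\|_{\mathcal A}$ is equivalent on $\mathcal A$ to $\|A\|_{\alpha}:=\sum_{\beta\le\alpha}\big\|\big[\prod_{j=1}^d(k_j-l_j)^{\beta_j}A_{k,l}\big]_{k,l\in X}\big\|_{\mathcal S^1_\nu}$, where $\|\cdot\|_{\mathcal S^1_\nu}$ is the above norm with $\alpha=0$, and $|||A|||:=\sup\{\|AB\|_{\alpha}:B\in\mathcal A,\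 \|B\|_{\alpha}=1\}$ (with $\sup\emptyset=0$) is an equivalent submultiplicative norm on $\mathcal A$. (4) Via $A(f_l)_{l\in X}=\big(\sum_{l\in X}A_{k,l}f_l\big)_{k\in X}$, each $A\in\mathcal A$ is a bounded operator on $\ell^2(X;\mathcal H)$; this identifies $\mathcal A$ with a unital $*$-subalgebra of $\mathcal B(\ell^2(X;\mathcal H))$, which is inverse-closed: if $A\in\mathcal A$ is invertible in $\mathcal B(\ell^2(X;\mathcal H))$, then $A^{-1}\in\mathcal A$. (5) $\mathcal A$ is symmetric: $\sigma_{\mathcal A}(A^*A)\subseteq[0,\infty)$ for all $A\in\mathcal A$. -/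

import Mathlib

open scoped ENNReal NNReal Topology

/-- A weight on `ℝ^d`: a continuous, strictly positive function. -/
structure IsWeight {d : ℕ} (ν : EuclideanSpace ℝ (Fin d) → ℝ) : Prop where
  continuous : Continuous ν
  pos : ∀ x, 0 < ν x

/-- The Gelfand-Raikov-Shilov condition. -/
def SatisfiesGRS {d : ℕ} (ν : EuclideanSpace ℝ (Fin d) → ℝ) : Prop :=
  ∀ z : EuclideanSpace ℝ (Fin d),
    Filter.Tendsto (fun n : ℕ => (ν ((n : ℝ) • z)) ^ (1 / (n : ℝ))) Filter.atTop (𝓝 1)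

/-- An admissible weight: `ν x = exp (ρ (p x))` with `p` an arbitrary norm on `ℝ^d` (a seminorm
which vanishes only at `0`) and `ρ : [0,∞) → [0,∞)` continuous, concave, `ρ 0 = 0`; and `ν`
satisfies the GRS condition. Only the values of `ρ` on `[0,∞)` matter. -/
structure IsAdmissibleWeight {d : ℕ} (ν : EuclideanSpace ℝ (Fin d) → ℝ) : Prop
    extends IsWeight ν where
  exists_form : ∃ (p : Seminorm ℝ (EuclideanSpace ℝ (Fin d))) (ρ : ℝ → ℝ),
    (∀ x, p x = 0 → x = 0) ∧ ContinuousOn ρ (Set.Ici 0) ∧ ConcaveOn ℝ (Set.Ici 0) ρ ∧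
      (∀ t, 0 ≤ t → 0 ≤ ρ t) ∧ ρ 0 = 0 ∧ ∀ x, ν x = Real.exp (ρ (p x))
  grs : SatisfiesGRS ν

/-- A countable set `X ⊆ ℝ^d` is relatively separated if the number of its points in a
translate `x + [0,1]^d` of the unit cube is bounded independently of `x`. -/
structure IsRelativelySeparated {d : ℕ} (X : Set (EuclideanSpace ℝ (Fin d))) : Prop where
  countable : X.Countable
  bounded : ∃ N : ℕ, ∀ x : EuclideanSpace ℝ (Fin d),
    (X ∩ {y | ∀ j, x j ≤ y j ∧ y j ≤ x j + 1}).encard ≤ N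

/-- `B(H)`-valued matrices indexed by `X`. -/
abbrev OpMatrix {d : ℕ} (X : Set (EuclideanSpace ℝ (Fin d))) (H : Type*)
    [NormedAddCommGroup H] [InnerProductSpace ℂ H] : Type _ :=
  X → X → (H →L[ℂ] H)

/-- The Hilbert space `ℓ²(X; H)`. -/
abbrev EllTwo {d : ℕ} (X : Set (EuclideanSpace ℝ (Fin d))) (H : Type*)
    [NormedAddCommGroup H] [InnerProductSpace ℂ H] : Type _ :=
  lp (fun _ : X => H) 2

section Matrices

variable {d : ℕ} {X : Set (EuclideanSpace ℝ (Fin d))} {H : Type*}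
  [NormedAddCommGroup H] [InnerProductSpace ℂ H]

/-- The Schur norm with weight `w` of a matrix, as an extended nonnegative number: the maximum of
`sup_k ∑_l ‖A k l‖ w (k - l)` and `sup_l ∑_k ‖A k l‖ w (k - l)`. -/
noncomputable def schurENorm (w : EuclideanSpace ℝ (Fin d) → ℝ) (A : OpMatrix X H) : ℝ≥0∞ :=
  max
    (⨆ k : X, ∑' l : X, ENNReal.ofReal
      (‖A k l‖ * w ((k : EuclideanSpace ℝ (Fin d)) - (l : EuclideanSpace ℝ (Fin d)))))
    (⨆ l : X, ∑' k : X, ENNReal.ofReal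
      (‖A k l‖ * w ((k : EuclideanSpace ℝ (Fin d)) - (l : EuclideanSpace ℝ (Fin d)))))

/-- The anisotropic weight `x ↦ ∏ j, (1 + |x j|) ^ α j * ν x`. -/
noncomputable def anisoWeight (α : Fin d → ℕ) (ν : EuclideanSpace ℝ (Fin d) → ℝ)
    (x : EuclideanSpace ℝ (Fin d)) : ℝ :=
  (∏ j, (1 + |x j|) ^ α j) * ν x

/-- The iterated derivation `δ^β`, `δ_j A = [(k_j - l_j) A k l]`. -/
noncomputable def deltaPow (β : Fin d → ℕ) (A : OpMatrix X H) : OpMatrix X H :=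
  fun k l => ((∏ j, ((k : EuclideanSpace ℝ (Fin d)) j -
    (l : EuclideanSpace ℝ (Fin d)) j) ^ β j : ℝ) : ℂ) • A k l

/-- The graph norm `∑_{β ≤ α} ‖δ^β A‖`, the norms on the right being Schur norms with weight
`ν`. -/
noncomputable def graphENorm (α : Fin d → ℕ) (ν : EuclideanSpace ℝ (Fin d) → ℝ)
    (A : OpMatrix X H) : ℝ≥0∞ :=
  ∑ β ∈ Finset.Iic α, schurENorm ν (deltaPow β A)

end Matrices

/-- The anisotropic Schur-type class: the `B(H)`-valued matrices for which the row and column sums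
of `∏ j, (1 + |k j - l j|) ^ α j * ‖A k l‖ * ν (k - l)` are bounded. It is a bare type: no
algebraic or topological structure is attached to it here. -/
@[ext]
structure AnisoSchur {d : ℕ} (X : Set (EuclideanSpace ℝ (Fin d))) (H : Type*)
    [NormedAddCommGroup H] [InnerProductSpace ℂ H]
    (ν : EuclideanSpace ℝ (Fin d) → ℝ) (α : Fin d → ℕ) where
  entry : OpMatrix X H
  finite : schurENorm (anisoWeight α ν) entry < ∞

/-- `A`, embedded in `B` by `φ`, is inverse-closed in `B`: the inverse in `B` of an element of `A`
lies in `A`. -/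
def IsInverseClosed {A B : Type*} [Ring A] [Algebra ℂ A] [Star A] [Ring B] [Algebra ℂ B] [Star B]
    (φ : A →⋆ₐ[ℂ] B) : Prop :=
  ∀ a : A, ∀ b : B, φ a * b = 1 → b * φ a = 1 → ∃ a' : A, φ a' = b

/-- A *-algebra is symmetric if `a* a` has spectrum in `[0,∞)` for all `a`. -/
def IsSymmetricStarAlgebra (A : Type*) [Ring A] [Algebra ℂ A] [Star A] : Prop :=
  ∀ a : A, ∀ z ∈ spectrum ℂ (star a * a), 0 ≤ z.re ∧ z.im = 0

/-! Inverse-closedness is the only deep point. The Banach algebra estimates express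
submultiplicativity of the weight, the algebraic laws are pulled back along the injection into
operators on ℓ², and symmetry follows from inverse-closedness.

By a C*-algebraic reduction (`isInverseClosed_of_isUnit_one_sub`) it suffices that 1 - A is
invertible in the class when A has operator norm q < 1 on ℓ². The operator norm bounds every entry.
In a product, cut at distance s from the diagonal. Terms with one factor inside the band cost q
times a power of 1 + s, provided that the weight is polynomially bounded on balls. Terms with both
factors outside gain a factor (2/(1+s))^δ if the exponent of the weight behaves like a logarithm.
This gives (`schurENorm_matrixMul_le_interpolation`) ‖A²‖ ≤ C (1+s)^D q ‖A‖ + (2/(1+s))^δ ‖A‖².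

The given weight may grow too fast for this, so its exponent ρ is replaced by min(ρ(t), (δ/2)
log(1+t) + t/(j+1)) (`exists_isWeightTruncation`). The GRS condition makes ρ sublinear, so the new
weights u_j are all equivalent to the original one; for fixed s and large j they satisfy both
requirements with constants independent of j. Hence the infimum N over j of the u_j-norms obeys the
displayed inequality for every s.

Applying it to A^(2^m), of operator norm at most q^(2^m), with s exponentially large in 2^m, yields
N_{m+1} ≤ C τ^(2^m) N_m² with τ < 1 as long as N_m ≥ 1. This forces N_m < 1 for some m. Then some
u_j-norm of A^(2^m) is below 1, its powers tend to 0 in the original norm, and 1 - A divides an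
element inverted by a Neumann series. -/

set_option linter.unusedSectionVars false

/-! ### Row and column sums of nonnegative kernels, and Schur's test -/

section Kernels

variable {ι : Type*}

/-- The Schur norm of a nonnegative kernel: the larger of the supremum of its row sums and the
supremum of its column sums. -/
noncomputable def kernelSchur (a : ι → ι → ℝ≥0∞) : ℝ≥0∞ :=
  max (⨆ k, ∑' l, a k l) (⨆ l, ∑' k, a k l)

theorem kernelSchur_le {a : ι → ι → ℝ≥0∞} {M : ℝ≥0∞} (h₁ : ∀ k, ∑' l, a k l ≤ M)
    (h₂ : ∀ l, ∑' k, a k l ≤ M) : kernelSchur a ≤ M :=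
  max_le (iSup_le h₁) (iSup_le h₂)

theorem row_le_kernelSchur (a : ι → ι → ℝ≥0∞) (k : ι) : ∑' l, a k l ≤ kernelSchur a :=
  (le_iSup (fun k => ∑' l, a k l) k).trans (le_max_left _ _)

theorem col_le_kernelSchur (a : ι → ι → ℝ≥0∞) (l : ι) : ∑' k, a k l ≤ kernelSchur a :=
  (le_iSup (fun l => ∑' k, a k l) l).trans (le_max_right _ _)

theorem entry_le_kernelSchur (a : ι → ι → ℝ≥0∞) (k l : ι) : a k l ≤ kernelSchur a :=
  (ENNReal.le_tsum l).trans (row_le_kernelSchur a k)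

theorem kernelSchur_mono {a b : ι → ι → ℝ≥0∞} (h : ∀ k l, a k l ≤ b k l) :
    kernelSchur a ≤ kernelSchur b :=
  kernelSchur_le (fun k => (ENNReal.tsum_le_tsum (h k)).trans (row_le_kernelSchur b k))
    (fun l => (ENNReal.tsum_le_tsum fun k => h k l).trans (col_le_kernelSchur b l))

theorem kernelSchur_swap_le (a : ι → ι → ℝ≥0∞) :
    kernelSchur (fun k l => a l k) ≤ kernelSchur a :=
  kernelSchur_le (col_le_kernelSchur a) (row_le_kernelSchur a)

theorem kernelSchur_add_le (a b : ι → ι → ℝ≥0∞) :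
    kernelSchur (fun k l => a k l + b k l) ≤ kernelSchur a + kernelSchur b :=
  kernelSchur_le
    (fun k => ENNReal.tsum_add.trans_le
      (add_le_add (row_le_kernelSchur a k) (row_le_kernelSchur b k)))
    (fun l => ENNReal.tsum_add.trans_le
      (add_le_add (col_le_kernelSchur a l) (col_le_kernelSchur b l)))

theorem kernelSchur_sum_le {β : Type*} (s : Finset β) (a : β → ι → ι → ℝ≥0∞) :
    kernelSchur (fun k l => ∑ i ∈ s, a i k l) ≤ ∑ i ∈ s, kernelSchur (a i) := by
  classical
  induction s using Finset.induction_on with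
  | empty => exact kernelSchur_le (by simp) (by simp)
  | insert i s hi ih =>
    simp only [Finset.sum_insert hi]
    exact (kernelSchur_add_le _ _).trans (add_le_add le_rfl ih)

theorem kernelSchur_const_mul_le (c : ℝ≥0∞) (a : ι → ι → ℝ≥0∞) :
    kernelSchur (fun k l => c * a k l) ≤ c * kernelSchur a :=
  kernelSchur_le
    (fun k => ENNReal.tsum_mul_left.trans_le (by gcongr; exact row_le_kernelSchur a k))
    (fun l => ENNReal.tsum_mul_left.trans_le (by gcongr; exact col_le_kernelSchur a l))

theorem kernelSchur_comp_le (a b : ι → ι → ℝ≥0∞) :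
    kernelSchur (fun k l => ∑' n, a k n * b n l) ≤ kernelSchur a * kernelSchur b := by
  refine kernelSchur_le (fun k => ?_) (fun l => ?_)
  · rw [ENNReal.tsum_comm]
    calc ∑' n, ∑' l, a k n * b n l ≤ ∑' n, a k n * kernelSchur b :=
          ENNReal.tsum_le_tsum fun n => by
            rw [ENNReal.tsum_mul_left]; gcongr; exact row_le_kernelSchur b n
      _ ≤ _ := by rw [ENNReal.tsum_mul_right]; gcongr; exact row_le_kernelSchur a k
  · rw [ENNReal.tsum_comm]
    calc ∑' n, ∑' k, a k n * b n l ≤ ∑' n, kernelSchur a * b n l :=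
          ENNReal.tsum_le_tsum fun n => by
            rw [ENNReal.tsum_mul_right]; gcongr; exact col_le_kernelSchur a n
      _ ≤ _ := by rw [ENNReal.tsum_mul_left]; gcongr; exact col_le_kernelSchur b l

theorem ENNReal.two_mul_mul_le_sq_add_sq (x y : ℝ≥0∞) : 2 * (x * y) ≤ x ^ 2 + y ^ 2 := by
  induction x with
  | top => simp
  | coe x =>
    induction y with
    | top => simp
    | coe y => exact_mod_cast (mul_assoc 2 x y).symm.trans_le (two_mul_le_add_sq x y)

/-- Cauchy–Schwarz by symmetrisation: expand the square as a double sum and use 2 f_l f_m ≤ f_l² +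
f_m². In [0,∞] no summability has to be discussed. -/
theorem ENNReal.tsum_mul_sq_le (a f : ι → ℝ≥0∞) :
    (∑' l, a l * f l) ^ 2 ≤ (∑' l, a l) * ∑' l, a l * f l ^ 2 := by
  have h : 2 * (∑' l, a l * f l) ^ 2 ≤ 2 * ((∑' l, a l) * ∑' l, a l * f l ^ 2) := by
    calc 2 * (∑' l, a l * f l) ^ 2
        = ∑' l, ∑' m, a l * a m * (2 * (f l * f m)) := by
          simp only [sq, ← ENNReal.tsum_mul_right, ← ENNReal.tsum_mul_left]
          refine tsum_congr fun l => tsum_congr fun m => by ring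
      _ ≤ ∑' l, ∑' m, a l * a m * (f l ^ 2 + f m ^ 2) := by
          gcongr; exact ENNReal.two_mul_mul_le_sq_add_sq _ _
      _ = (∑' l, ∑' m, (a l * f l ^ 2) * a m) + ∑' l, ∑' m, a l * (a m * f m ^ 2) := by
          rw [← ENNReal.tsum_add]
          refine tsum_congr fun l => ?_
          rw [← ENNReal.tsum_add]
          exact tsum_congr fun m => by ring
      _ = 2 * ((∑' l, a l) * ∑' l, a l * f l ^ 2) := by
          simp only [ENNReal.tsum_mul_left, ENNReal.tsum_mul_right]
          ring
  exact (ENNReal.mul_le_mul_iff_right (by simp) (by simp)).1 h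

/-- Schur's test. -/
theorem ENNReal.tsum_tsum_mul_sq_le (a : ι → ι → ℝ≥0∞) (f : ι → ℝ≥0∞) :
    ∑' k, (∑' l, a k l * f l) ^ 2 ≤ kernelSchur a ^ 2 * ∑' l, f l ^ 2 := by
  calc ∑' k, (∑' l, a k l * f l) ^ 2
      ≤ ∑' k, kernelSchur a * ∑' l, a k l * f l ^ 2 := by
        gcongr with k
        exact (ENNReal.tsum_mul_sq_le _ _).trans (by gcongr; exact row_le_kernelSchur a k)
    _ = kernelSchur a * ∑' l, (∑' k, a k l) * f l ^ 2 := by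
        rw [ENNReal.tsum_mul_left, ENNReal.tsum_comm]
        simp only [ENNReal.tsum_mul_right]
    _ ≤ kernelSchur a * ∑' l, kernelSchur a * f l ^ 2 := by
        gcongr with l; exact col_le_kernelSchur a l
    _ = _ := by rw [ENNReal.tsum_mul_left]; ring

end Kernels

/-! ### Matrices as operators on ℓ² -/

section MatrixOperators

variable {ι H : Type*} [NormedAddCommGroup H] [InnerProductSpace ℂ H]

theorem memℓp_two_of_tsum_enorm {g : ι → H} (h : ∑' k, ‖g k‖ₑ ^ 2 ≠ ∞) :
    Memℓp g 2 := by
  refine memℓp_gen ?_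
  have h' : ∑' k, ((‖g k‖₊ ^ 2 : ℝ≥0) : ℝ≥0∞) ≠ ∞ := by
    simpa [enorm_eq_nnnorm] using h
  have := NNReal.summable_coe.2 (ENNReal.tsum_coe_ne_top_iff_summable.1 h')
  simpa using this

theorem lp_two_tsum_enorm_sq (f : lp (fun _ : ι => H) 2) : ∑' k, ‖f k‖ₑ ^ 2 = ‖f‖ₑ ^ 2 := by
  have h := lp.norm_rpow_eq_tsum (p := 2) (by norm_num) f
  have hs := (lp.memℓp f).summable (p := 2) (by norm_num)
  simp only [ENNReal.toReal_ofNat, Real.rpow_ofNat] at h hs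
  have e : ∀ x : ℝ, 0 ≤ x → ENNReal.ofReal (x ^ 2) = ENNReal.ofReal x ^ 2 :=
    fun x hx => ENNReal.ofReal_pow hx 2
  rw [← ofReal_norm, ← e _ (norm_nonneg _), h, ENNReal.ofReal_tsum_of_nonneg (by intro; positivity) hs]
  refine tsum_congr fun k => ?_
  rw [e _ (norm_nonneg _), ofReal_norm]

variable (A : ι → ι → (H →L[ℂ] H))

theorem kernelSchur_row_ne_top (hA : kernelSchur (fun k l => ‖A k l‖ₑ) ≠ ∞) (k : ι) :
    ∑' l, ‖A k l‖ₑ ≠ ∞ :=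
  ne_top_of_le_ne_top hA (row_le_kernelSchur (fun k l => ‖A k l‖ₑ) k)

variable [CompleteSpace H]

theorem summable_matrix_apply (hA : kernelSchur (fun k l => ‖A k l‖ₑ) ≠ ∞)
    (f : lp (fun _ : ι => H) 2) (k : ι) : Summable fun l => A k l (f l) := by
  refine Summable.of_enorm (ne_top_of_le_ne_top
    (ENNReal.mul_ne_top (kernelSchur_row_ne_top A hA k) (enorm_ne_top (x := f))) ?_)
  rw [← ENNReal.tsum_mul_right]
  gcongr with l
  refine ((A k l).le_opENorm _).trans ?_
  gcongr
  exact enorm_le_iff_norm_le.2 (lp.norm_apply_le_norm (by norm_num) f l)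

theorem matrix_apply_enorm_le (f : lp (fun _ : ι => H) 2) :
    ∑' k, ‖∑' l, A k l (f l)‖ₑ ^ 2 ≤ (kernelSchur (fun k l => ‖A k l‖ₑ) * ‖f‖ₑ) ^ 2 := by
  rw [mul_pow, ← lp_two_tsum_enorm_sq]
  refine le_trans ?_ (ENNReal.tsum_tsum_mul_sq_le _ _)
  gcongr with k
  refine enorm_tsum_le_tsum_enorm.trans ?_
  gcongr with l
  exact (A k l).le_opENorm _

/-- The operator on `ℓ²` defined by a matrix of finite Schur norm. -/
noncomputable def matrixOperator (hA : kernelSchur (fun k l => ‖A k l‖ₑ) ≠ ∞) :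
    lp (fun _ : ι => H) 2 →L[ℂ] lp (fun _ : ι => H) 2 :=
  LinearMap.mkContinuous
    { toFun := fun f => ⟨fun k => ∑' l, A k l (f l), memℓp_two_of_tsum_enorm
        (ne_top_of_le_ne_top (ENNReal.pow_ne_top (ENNReal.mul_ne_top hA enorm_ne_top))
          (matrix_apply_enorm_le A f))⟩
      map_add' := fun f g => by
        ext k
        simp only [lp.coeFn_add, Pi.add_apply, map_add]
        exact (summable_matrix_apply A hA f k).tsum_add (summable_matrix_apply A hA g k)
      map_smul' := fun c f => by
        ext k
        simp only [lp.coeFn_smul, Pi.smul_apply, map_smul, RingHom.id_apply]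
        exact (summable_matrix_apply A hA f k).tsum_const_smul c }
    (kernelSchur (fun k l => ‖A k l‖ₑ)).toReal
    (fun f => by
      have h := matrix_apply_enorm_le A f
      set g : lp (fun _ : ι => H) 2 := ⟨fun k => ∑' l, A k l (f l), memℓp_two_of_tsum_enorm
        (ne_top_of_le_ne_top (ENNReal.pow_ne_top (ENNReal.mul_ne_top hA enorm_ne_top))
          (matrix_apply_enorm_le A f))⟩ with hg
      have h1 : ‖g‖ₑ ^ 2 ≤ (kernelSchur (fun k l => ‖A k l‖ₑ) * ‖f‖ₑ) ^ 2 := by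
        rw [← lp_two_tsum_enorm_sq]; exact h
      have h2 := (ENNReal.pow_le_pow_left_iff two_ne_zero).1 h1
      have h3 := ENNReal.toReal_mono (ENNReal.mul_ne_top hA enorm_ne_top) h2
      simpa using h3)

theorem matrixOperator_hasSum (hA : kernelSchur (fun k l => ‖A k l‖ₑ) ≠ ∞)
    (f : lp (fun _ : ι => H) 2) (k : ι) :
    HasSum (fun l => A k l (f l)) (matrixOperator A hA f k) :=
  (summable_matrix_apply A hA f k).hasSum

theorem matrixOperator_single [DecidableEq ι] (hA : kernelSchur (fun k l => ‖A k l‖ₑ) ≠ ∞)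
    (l : ι) (v : H) (k : ι) :
    matrixOperator A hA (lp.single 2 l v) k = A k l v := by
  refine (matrixOperator_hasSum A hA _ k).unique ?_
  have h := hasSum_single (f := fun n => A k n ((lp.single 2 l v : lp (fun _ : ι => H) 2) n)) l
    (fun n hn => by simp [Pi.single_eq_of_ne hn])
  simpa only [lp.single_apply_self] using h

theorem ellTwo_operator_ext [DecidableEq ι]
    {S T : lp (fun _ : ι => H) 2 →L[ℂ] lp (fun _ : ι => H) 2}
    (h : ∀ l (v : H) k, S (lp.single 2 l v) k = T (lp.single 2 l v) k) : S = T := by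
  ext1 f
  have hf := lp.hasSum_single (p := 2) (by norm_num) f
  have h1 := hf.mapL S
  have h2 := hf.mapL T
  refine h1.unique ?_
  convert h2 using 2 with l
  ext k
  exact h l _ k

/-- A column is the image of a vector supported at one index. Through this bound the operator norm
enters the proof of inverse-closedness. -/
theorem norm_entry_le_matrixOperator (hA : kernelSchur (fun k l => ‖A k l‖ₑ) ≠ ∞) (k l : ι) :
    ‖A k l‖ ≤ ‖matrixOperator A hA‖ := by
  classical
  refine (A k l).opNorm_le_bound (norm_nonneg _) fun v => ?_
  rw [← matrixOperator_single A hA l v k]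
  refine (lp.norm_apply_le_norm (by norm_num) _ k).trans ?_
  refine ((matrixOperator A hA).le_opNorm _).trans_eq ?_
  rw [lp.norm_single (by norm_num)]

theorem summable_matrix_mul {A B : ι → ι → (H →L[ℂ] H)}
    (hA : kernelSchur (fun k l => ‖A k l‖ₑ) ≠ ∞) (hB : kernelSchur (fun k l => ‖B k l‖ₑ) ≠ ∞)
    (k l : ι) : Summable fun n => A k n * B n l := by
  refine Summable.of_enorm (ne_top_of_le_ne_top
    (ENNReal.mul_ne_top (kernelSchur_row_ne_top A hA k) hB) ?_)
  rw [← ENNReal.tsum_mul_right]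
  gcongr with n
  refine ((A k n).opENorm_comp_le (B n l)).trans ?_
  gcongr
  exact entry_le_kernelSchur (fun k l => ‖B k l‖ₑ) n l

end MatrixOperators

/-! ### Weighted Schur norms -/

/-- A symmetric submultiplicative weight, normalised at the origin. -/
structure IsSubmultWeight {d : ℕ} (w : EuclideanSpace ℝ (Fin d) → ℝ) : Prop where
  map_zero : w 0 = 1
  one_le : ∀ x, 1 ≤ w x
  map_neg : ∀ x, w (-x) = w x
  map_add_le : ∀ x y, w (x + y) ≤ w x * w y

section SchurNorm

variable {d : ℕ} {X : Set (EuclideanSpace ℝ (Fin d))} {H : Type*}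
  [NormedAddCommGroup H] [InnerProductSpace ℂ H] {w : EuclideanSpace ℝ (Fin d) → ℝ}

theorem schurENorm_eq_kernelSchur (w : EuclideanSpace ℝ (Fin d) → ℝ) (A : OpMatrix X H) :
    schurENorm w A = kernelSchur fun k l : X =>
      ‖A k l‖ₑ * ENNReal.ofReal (w ((k : EuclideanSpace ℝ (Fin d)) - l)) := by
  simp only [schurENorm, kernelSchur, ENNReal.ofReal_mul (norm_nonneg _), ofReal_norm]

theorem IsSubmultWeight.one_le_ofReal (hw : IsSubmultWeight w) (x : EuclideanSpace ℝ (Fin d)) :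
    1 ≤ ENNReal.ofReal (w x) := by
  rw [← ENNReal.ofReal_one]; exact ENNReal.ofReal_le_ofReal (hw.one_le x)

theorem kernelSchur_enorm_le_schurENorm (hw : IsSubmultWeight w) (A : OpMatrix X H) :
    kernelSchur (fun k l : X => ‖A k l‖ₑ) ≤ schurENorm w A := by
  rw [schurENorm_eq_kernelSchur]
  exact kernelSchur_mono fun k l => le_mul_of_one_le_right' (hw.one_le_ofReal _)

theorem enorm_entry_le_schurENorm (hw : IsSubmultWeight w) (A : OpMatrix X H) (k l : X) :
    ‖A k l‖ₑ ≤ schurENorm w A :=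
  (entry_le_kernelSchur (fun k l : X => ‖A k l‖ₑ) k l).trans
    (kernelSchur_enorm_le_schurENorm hw A)

theorem schurENorm_mono {A B : OpMatrix X H} (h : ∀ k l, ‖A k l‖ ≤ ‖B k l‖) :
    schurENorm w A ≤ schurENorm w B := by
  rw [schurENorm_eq_kernelSchur, schurENorm_eq_kernelSchur]
  refine kernelSchur_mono fun k l => ?_
  gcongr
  exact enorm_le_iff_norm_le.2 (h k l)

theorem schurENorm_add_le (A B : OpMatrix X H) :
    schurENorm w (A + B) ≤ schurENorm w A + schurENorm w B := by
  simp only [schurENorm_eq_kernelSchur]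
  refine (kernelSchur_mono fun k l => ?_).trans (kernelSchur_add_le _ _)
  rw [← add_mul]
  gcongr
  exact enorm_add_le (A k l) (B k l)

theorem schurENorm_smul (c : ℂ) (A : OpMatrix X H) :
    schurENorm w (c • A) = ‖c‖ₑ * schurENorm w A := by
  have key : ∀ (c : ℂ) (A : OpMatrix X H), schurENorm w (c • A) ≤ ‖c‖ₑ * schurENorm w A := by
    intro c A
    simp only [schurENorm_eq_kernelSchur]
    refine (kernelSchur_mono fun k l => ?_).trans (kernelSchur_const_mul_le _ _)
    rw [Pi.smul_apply, Pi.smul_apply, enorm_smul, mul_assoc]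
  refine le_antisymm (key c A) ?_
  rcases eq_or_ne c 0 with rfl | hc
  · simp
  · calc ‖c‖ₑ * schurENorm w A = ‖c‖ₑ * schurENorm w (c⁻¹ • c • A) := by
          rw [inv_smul_smul₀ hc]
      _ ≤ ‖c‖ₑ * (‖c⁻¹‖ₑ * schurENorm w (c • A)) := by gcongr; exact key _ _
      _ = schurENorm w (c • A) := by
          rw [← mul_assoc, ← enorm_mul, mul_inv_cancel₀ hc]; simp

theorem schurENorm_neg (A : OpMatrix X H) : schurENorm w (-A) = schurENorm w A :=
  le_antisymm (schurENorm_mono fun k l => by simp) (schurENorm_mono fun k l => by simp)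

theorem schurENorm_zero : schurENorm w (0 : OpMatrix X H) = 0 := by
  have := schurENorm_smul (w := w) 0 (0 : OpMatrix X H)
  simpa using this

theorem eq_zero_of_schurENorm_eq_zero (hw : IsSubmultWeight w) {A : OpMatrix X H}
    (h : schurENorm w A = 0) : A = 0 := by
  funext k l
  have := enorm_entry_le_schurENorm hw A k l
  rw [h, nonpos_iff_eq_zero, enorm_eq_nnnorm, ENNReal.coe_eq_zero, nnnorm_eq_zero] at this
  exact this

/-- The product of two matrices of operators. -/
noncomputable def matrixMul (A B : OpMatrix X H) : OpMatrix X H :=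
  fun k l => ∑' n, A k n * B n l

theorem schurENorm_matrixMul_le (hw : IsSubmultWeight w) (A B : OpMatrix X H) :
    schurENorm w (matrixMul A B) ≤ schurENorm w A * schurENorm w B := by
  simp only [schurENorm_eq_kernelSchur]
  refine (kernelSchur_mono fun k l => ?_).trans (kernelSchur_comp_le _ _)
  calc ‖matrixMul A B k l‖ₑ * ENNReal.ofReal (w (k - l))
      ≤ (∑' n, ‖A k n‖ₑ * ‖B n l‖ₑ) * ENNReal.ofReal (w (k - l)) := by
        gcongr
        refine (enorm_tsum_le_tsum_enorm (f := fun n => A k n * B n l)).trans ?_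
        gcongr with n
        exact (A k n).opENorm_comp_le (B n l)
    _ ≤ _ := by
        rw [← ENNReal.tsum_mul_right]
        refine ENNReal.tsum_le_tsum fun n => ?_
        have h1 : w ((k : EuclideanSpace ℝ (Fin d)) - l) ≤ w (k - n) * w (n - l) := by
          have := hw.map_add_le ((k : EuclideanSpace ℝ (Fin d)) - n) (n - l)
          rwa [sub_add_sub_cancel] at this
        have h2 := ENNReal.ofReal_le_ofReal h1
        rw [ENNReal.ofReal_mul (zero_le_one.trans (hw.one_le _))] at h2
        calc _ ≤ ‖A k n‖ₑ * ‖B n l‖ₑ * (ENNReal.ofReal (w (k - n)) * ENNReal.ofReal (w (n - l))) := by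
              gcongr
          _ = _ := by ring

/-- Only an inequality: the identity has norm 0 when X is empty or H is trivial. -/
theorem schurENorm_one_le (hw : IsSubmultWeight w) [DecidableEq X] :
    schurENorm w (fun k l : X => if k = l then (1 : H →L[ℂ] H) else 0) ≤ 1 := by
  have h0 : ‖(0 : H →L[ℂ] H)‖ₑ = 0 := by rw [enorm_eq_nnnorm, nnnorm_zero, ENNReal.coe_zero]
  have h1 : ‖(1 : H →L[ℂ] H)‖ₑ ≤ 1 := by
    rw [← enorm_one (G := ℝ)]
    exact enorm_le_iff_norm_le.2 (by simpa using! ContinuousLinearMap.norm_id_le (𝕜 := ℂ) (E := H))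
  rw [schurENorm_eq_kernelSchur]
  refine kernelSchur_le (fun k => ?_) (fun l => ?_)
  · rw [tsum_eq_single k (fun l hl => by simp [hl.symm, h0])]
    simpa [hw.map_zero] using h1
  · rw [tsum_eq_single l (fun k hk => by simp [hk, h0])]
    simpa [hw.map_zero] using h1

theorem schurENorm_adjoint [CompleteSpace H] (hw : IsSubmultWeight w) (A : OpMatrix X H) :
    schurENorm w (fun k l => ContinuousLinearMap.adjoint (A l k)) = schurENorm w A := by
  have key : ∀ A : OpMatrix X H,
      schurENorm w (fun k l => ContinuousLinearMap.adjoint (A l k)) ≤ schurENorm w A := by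
    intro A
    simp only [schurENorm_eq_kernelSchur]
    refine le_trans (kernelSchur_mono fun k l => ?_) (kernelSchur_swap_le _)
    rw [← hw.map_neg, neg_sub]
    gcongr
    exact enorm_le_iff_norm_le.2 (ContinuousLinearMap.adjoint.norm_map _).le
  refine le_antisymm (key A) ?_
  simpa using key (fun k l => ContinuousLinearMap.adjoint (A l k))

/-- Fatou: finite partial sums are continuous in the entries, so balls are closed under entrywise
convergence. This drives completeness. -/
theorem schurENorm_le_of_tendsto {β : Type*} {F : Filter β} [F.NeBot]
    {A : β → OpMatrix X H} {B : OpMatrix X H} {M : ℝ≥0∞}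
    (hAB : ∀ k l, Filter.Tendsto (fun i => A i k l) F (𝓝 (B k l)))
    (hM : ∀ᶠ i in F, schurENorm w (A i) ≤ M) : schurENorm w B ≤ M := by
  simp only [schurENorm_eq_kernelSchur] at hM ⊢
  have ht : ∀ k l : X, Filter.Tendsto (fun i => ‖A i k l‖ₑ * ENNReal.ofReal (w (k - l))) F
      (𝓝 (‖B k l‖ₑ * ENNReal.ofReal (w (k - l)))) := fun k l =>
    ENNReal.Tendsto.mul_const ((hAB k l).enorm) (Or.inr ENNReal.ofReal_ne_top)
  refine kernelSchur_le (fun k => ?_) (fun l => ?_)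
  · rw [ENNReal.tsum_eq_iSup_sum]
    refine iSup_le fun s => le_of_tendsto (tendsto_finsetSum s fun l _ => ht k l) ?_
    filter_upwards [hM] with i hi
    exact ((ENNReal.sum_le_tsum s).trans (row_le_kernelSchur _ k)).trans hi
  · rw [ENNReal.tsum_eq_iSup_sum]
    refine iSup_le fun s => le_of_tendsto (tendsto_finsetSum s fun k _ => ht k l) ?_
    filter_upwards [hM] with i hi
    exact ((ENNReal.sum_le_tsum s).trans (col_le_kernelSchur (fun k l : X =>
      ‖A i k l‖ₑ * ENNReal.ofReal (w (k - l))) l)).trans hi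

end SchurNorm

/-! ### The Banach *-algebra and its embedding into the bounded operators -/

namespace AnisoSchur

variable {d : ℕ} {X : Set (EuclideanSpace ℝ (Fin d))} {H : Type*}
  [NormedAddCommGroup H] [InnerProductSpace ℂ H] [CompleteSpace H]
  {ν : EuclideanSpace ℝ (Fin d) → ℝ} {α : Fin d → ℕ}

variable [hw : Fact (IsSubmultWeight (anisoWeight α ν))]

theorem kernelSchur_entry_ne_top (A : AnisoSchur X H ν α) :
    kernelSchur (fun k l : X => ‖A.entry k l‖ₑ) ≠ ∞ :=
  ne_top_of_le_ne_top A.finite.ne (kernelSchur_enorm_le_schurENorm hw.out A.entry)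

/-- The operator on `ℓ²(X; H)` defined by a matrix. -/
noncomputable def toOperator (A : AnisoSchur X H ν α) : EllTwo X H →L[ℂ] EllTwo X H :=
  matrixOperator A.entry A.kernelSchur_entry_ne_top

theorem toOperator_hasSum (A : AnisoSchur X H ν α) (f : EllTwo X H) (k : X) :
    HasSum (fun l => A.entry k l (f l)) (A.toOperator f k) :=
  matrixOperator_hasSum _ _ f k

theorem toOperator_single [DecidableEq X] (A : AnisoSchur X H ν α) (l : X) (v : H) (k : X) :
    A.toOperator (lp.single 2 l v) k = A.entry k l v :=
  matrixOperator_single _ _ l v k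

theorem norm_entry_le_toOperator (A : AnisoSchur X H ν α) (k l : X) :
    ‖A.entry k l‖ ≤ ‖A.toOperator‖ :=
  norm_entry_le_matrixOperator _ _ k l

/-- Entries are recovered from vectors supported at one index. The algebraic laws below are pulled
back along this injection, so associativity of the matrix product needs no interchange of sums. -/
theorem toOperator_injective :
    Function.Injective (toOperator : AnisoSchur X H ν α → EllTwo X H →L[ℂ] EllTwo X H) := by
  classical
  intro A B h
  apply AnisoSchur.ext
  funext k l
  ext v
  rw [← toOperator_single, ← toOperator_single, h]

noncomputable scoped instance : Zero (AnisoSchur X H ν α) := ⟨⟨0, by simp [schurENorm_zero]⟩⟩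

noncomputable scoped instance : Add (AnisoSchur X H ν α) :=
  ⟨fun A B => ⟨A.entry + B.entry,
    (schurENorm_add_le _ _).trans_lt (ENNReal.add_lt_top.2 ⟨A.finite, B.finite⟩)⟩⟩

noncomputable scoped instance : Neg (AnisoSchur X H ν α) :=
  ⟨fun A => ⟨-A.entry, (schurENorm_neg _).trans_lt A.finite⟩⟩

noncomputable scoped instance : Sub (AnisoSchur X H ν α) :=
  ⟨fun A B => ⟨A.entry - B.entry, by
    rw [sub_eq_add_neg]
    refine (schurENorm_add_le _ _).trans_lt (ENNReal.add_lt_top.2 ⟨A.finite, ?_⟩)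
    exact (schurENorm_neg _).trans_lt B.finite⟩⟩

noncomputable scoped instance : SMul ℂ (AnisoSchur X H ν α) :=
  ⟨fun c A => ⟨c • A.entry, by
    rw [schurENorm_smul]; exact ENNReal.mul_lt_top enorm_lt_top A.finite⟩⟩

open Classical in
noncomputable scoped instance : One (AnisoSchur X H ν α) :=
  ⟨⟨fun k l => if k = l then 1 else 0,
    (schurENorm_one_le hw.out).trans_lt ENNReal.one_lt_top⟩⟩

noncomputable scoped instance : Mul (AnisoSchur X H ν α) :=
  ⟨fun A B => ⟨matrixMul A.entry B.entry,
    (schurENorm_matrixMul_le hw.out _ _).trans_lt (ENNReal.mul_lt_top A.finite B.finite)⟩⟩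

noncomputable scoped instance : Star (AnisoSchur X H ν α) :=
  ⟨fun A => ⟨fun k l => ContinuousLinearMap.adjoint (A.entry l k),
    (schurENorm_adjoint hw.out A.entry).trans_lt A.finite⟩⟩

noncomputable scoped instance : Norm (AnisoSchur X H ν α) :=
  ⟨fun A => (schurENorm (anisoWeight α ν) A.entry).toReal⟩

theorem norm_def (A : AnisoSchur X H ν α) :
    ‖A‖ = (schurENorm (anisoWeight α ν) A.entry).toReal := rfl

theorem add_entry (A B : AnisoSchur X H ν α) : (A + B).entry = A.entry + B.entry := rfl
theorem neg_entry (A : AnisoSchur X H ν α) : (-A).entry = -A.entry := rfl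
theorem sub_entry (A B : AnisoSchur X H ν α) : (A - B).entry = A.entry - B.entry := rfl
theorem zero_entry : (0 : AnisoSchur X H ν α).entry = 0 := rfl
theorem smul_entry (c : ℂ) (A : AnisoSchur X H ν α) : (c • A).entry = c • A.entry := rfl
theorem mul_entry (A B : AnisoSchur X H ν α) :
    (A * B).entry = matrixMul A.entry B.entry := rfl
open Classical in
theorem one_entry (k l : X) :
    (1 : AnisoSchur X H ν α).entry k l = if k = l then 1 else 0 := rfl
theorem star_entry (A : AnisoSchur X H ν α) (k l : X) :
    (star A).entry k l = ContinuousLinearMap.adjoint (A.entry l k) := rfl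

theorem mul_entry_hasSum (A B : AnisoSchur X H ν α) (k l : X) :
    HasSum (fun n => A.entry k n * B.entry n l) ((A * B).entry k l) :=
  (summable_matrix_mul A.kernelSchur_entry_ne_top B.kernelSchur_entry_ne_top k l).hasSum

theorem toOperator_add (A B : AnisoSchur X H ν α) :
    (A + B).toOperator = A.toOperator + B.toOperator := by
  classical
  refine ellTwo_operator_ext fun l v k => ?_
  rw [toOperator_single, _root_.add_apply, lp.coeFn_add, Pi.add_apply,
    toOperator_single, toOperator_single, add_entry]
  rfl

theorem toOperator_zero : (0 : AnisoSchur X H ν α).toOperator = 0 := by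
  classical
  refine ellTwo_operator_ext fun l v k => ?_
  rw [toOperator_single]; rfl

theorem toOperator_neg (A : AnisoSchur X H ν α) : (-A).toOperator = -A.toOperator := by
  classical
  refine ellTwo_operator_ext fun l v k => ?_
  rw [toOperator_single, _root_.neg_apply, lp.coeFn_neg, Pi.neg_apply,
    toOperator_single, neg_entry]
  rfl

theorem toOperator_sub (A B : AnisoSchur X H ν α) :
    (A - B).toOperator = A.toOperator - B.toOperator := by
  classical
  refine ellTwo_operator_ext fun l v k => ?_
  rw [toOperator_single, _root_.sub_apply, lp.coeFn_sub, Pi.sub_apply,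
    toOperator_single, toOperator_single, sub_entry]
  rfl

theorem toOperator_smul (c : ℂ) (A : AnisoSchur X H ν α) :
    (c • A).toOperator = c • A.toOperator := by
  classical
  refine ellTwo_operator_ext fun l v k => ?_
  rw [toOperator_single, _root_.smul_apply, lp.coeFn_smul, Pi.smul_apply,
    toOperator_single, smul_entry]
  rfl

theorem toOperator_one : (1 : AnisoSchur X H ν α).toOperator = 1 := by
  classical
  refine ellTwo_operator_ext fun l v k => ?_
  rw [toOperator_single, one_entry, one_apply_eq_self]
  by_cases h : k = l
  · subst h; simp
  · simp [h]

theorem toOperator_mul (A B : AnisoSchur X H ν α) :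
    (A * B).toOperator = A.toOperator * B.toOperator := by
  classical
  refine ellTwo_operator_ext fun l v k => ?_
  rw [toOperator_single, mul_apply_eq_comp]
  have h1 := toOperator_hasSum A (B.toOperator (lp.single 2 l v)) k
  simp only [toOperator_single] at h1
  refine HasSum.unique ?_ h1
  exact (mul_entry_hasSum A B k l).mapL (ContinuousLinearMap.apply ℂ H v)

theorem toOperator_star (A : AnisoSchur X H ν α) : (star A).toOperator = star A.toOperator := by
  classical
  refine ellTwo_operator_ext fun l v k => ?_
  rw [toOperator_single, star_entry, ContinuousLinearMap.star_eq_adjoint]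
  refine ext_inner_left ℂ fun u => ?_
  have h1 := lp.inner_single_left (𝕜 := ℂ) (G := fun _ : X => H) k u
    (ContinuousLinearMap.adjoint A.toOperator (lp.single 2 l v))
  have h2 := lp.inner_single_right (𝕜 := ℂ) (G := fun _ : X => H) l v
    (A.toOperator (lp.single 2 k u))
  rw [ContinuousLinearMap.adjoint_inner_right, h2, toOperator_single] at h1
  rw [ContinuousLinearMap.adjoint_inner_right]
  exact h1

noncomputable scoped instance : Ring (AnisoSchur X H ν α) where
  add_assoc A B C := toOperator_injective (by simp only [toOperator_add, add_assoc])
  zero_add A := toOperator_injective (by simp only [toOperator_add, toOperator_zero, zero_add])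
  add_zero A := toOperator_injective (by simp only [toOperator_add, toOperator_zero, add_zero])
  add_comm A B := toOperator_injective (by simp only [toOperator_add, add_comm])
  nsmul := nsmulRec
  zsmul := zsmulRec
  neg_add_cancel A := toOperator_injective
    (by simp only [toOperator_add, toOperator_neg, toOperator_zero, neg_add_cancel])
  sub_eq_add_neg A B := toOperator_injective
    (by simp only [toOperator_add, toOperator_neg, toOperator_sub, sub_eq_add_neg])
  mul_assoc A B C := toOperator_injective (by simp only [toOperator_mul, mul_assoc])
  one_mul A := toOperator_injective (by simp only [toOperator_mul, toOperator_one, one_mul])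
  mul_one A := toOperator_injective (by simp only [toOperator_mul, toOperator_one, mul_one])
  zero_mul A := toOperator_injective (by simp only [toOperator_mul, toOperator_zero, zero_mul])
  mul_zero A := toOperator_injective (by simp only [toOperator_mul, toOperator_zero, mul_zero])
  left_distrib A B C := toOperator_injective
    (by simp only [toOperator_mul, toOperator_add, mul_add])
  right_distrib A B C := toOperator_injective
    (by simp only [toOperator_mul, toOperator_add, add_mul])

noncomputable scoped instance : Module ℂ (AnisoSchur X H ν α) where
  one_smul A := toOperator_injective (by simp only [toOperator_smul, one_smul])
  mul_smul a b A := toOperator_injective (by simp only [toOperator_smul, mul_smul])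
  smul_zero a := toOperator_injective (by simp only [toOperator_smul, toOperator_zero, smul_zero])
  smul_add a A B := toOperator_injective (by simp only [toOperator_smul, toOperator_add, smul_add])
  add_smul a b A := toOperator_injective (by simp only [toOperator_smul, toOperator_add, add_smul])
  zero_smul A := toOperator_injective (by simp only [toOperator_smul, toOperator_zero, zero_smul])

noncomputable scoped instance : Algebra ℂ (AnisoSchur X H ν α) :=
  Algebra.ofModule
    (fun a A B => toOperator_injective (by simp only [toOperator_smul, toOperator_mul, smul_mul_assoc]))
    (fun a A B => toOperator_injective (by simp only [toOperator_smul, toOperator_mul, mul_smul_comm]))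

noncomputable scoped instance : StarRing (AnisoSchur X H ν α) where
  star_involutive A := toOperator_injective (by simp only [toOperator_star, star_star])
  star_mul A B := toOperator_injective (by simp only [toOperator_star, toOperator_mul, star_mul])
  star_add A B := toOperator_injective (by simp only [toOperator_star, toOperator_add, star_add])

scoped instance : StarModule ℂ (AnisoSchur X H ν α) where
  star_smul a A := toOperator_injective (by simp only [toOperator_star, toOperator_smul, star_smul])

theorem normedSpaceCore : NormedSpace.Core ℂ (AnisoSchur X H ν α) where
  norm_nonneg _ := ENNReal.toReal_nonneg
  norm_smul c A := by
    rw [norm_def, norm_def, smul_entry, schurENorm_smul, ENNReal.toReal_mul, toReal_enorm]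
  norm_triangle A B := by
    rw [norm_def, norm_def, norm_def, ← ENNReal.toReal_add A.finite.ne B.finite.ne]
    exact ENNReal.toReal_mono (ENNReal.add_ne_top.2 ⟨A.finite.ne, B.finite.ne⟩)
      (schurENorm_add_le _ _)
  norm_eq_zero_iff A := by
    rw [norm_def, ENNReal.toReal_eq_zero_iff, or_iff_left A.finite.ne]
    exact ⟨fun h => AnisoSchur.ext (eq_zero_of_schurENorm_eq_zero hw.out h),
      fun h => by rw [h, zero_entry, schurENorm_zero]⟩

noncomputable scoped instance : NormedRing (AnisoSchur X H ν α) where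
  __ := (inferInstance : Ring (AnisoSchur X H ν α))
  __ := NormedAddCommGroup.ofCore (𝕜 := ℂ) (E := AnisoSchur X H ν α) normedSpaceCore
  norm_mul_le A B := by
    rw [norm_def, norm_def, norm_def, ← ENNReal.toReal_mul]
    exact ENNReal.toReal_mono (ENNReal.mul_ne_top A.finite.ne B.finite.ne)
      (schurENorm_matrixMul_le hw.out _ _)

noncomputable scoped instance : NormedAlgebra ℂ (AnisoSchur X H ν α) where
  norm_smul_le c A := (normedSpaceCore.norm_smul c A).le

scoped instance : NormedStarGroup (AnisoSchur X H ν α) where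
  norm_star_le A := by
    rw [norm_def, norm_def]
    exact (congrArg ENNReal.toReal (schurENorm_adjoint hw.out A.entry)).le

theorem norm_entry_le (A : AnisoSchur X H ν α) (k l : X) : ‖A.entry k l‖ ≤ ‖A‖ := by
  have := ENNReal.toReal_mono A.finite.ne (enorm_entry_le_schurENorm hw.out A.entry k l)
  rwa [toReal_enorm] at this

theorem norm_le_iff (A : AnisoSchur X H ν α) {r : ℝ} (hr : 0 ≤ r) :
    ‖A‖ ≤ r ↔ schurENorm (anisoWeight α ν) A.entry ≤ ENNReal.ofReal r :=
  (ENNReal.le_ofReal_iff_toReal_le A.finite.ne hr).symm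

scoped instance : CompleteSpace (AnisoSchur X H ν α) := by
  refine Metric.complete_of_cauchySeq_tendsto fun A hA => ?_
  have hent : ∀ k l, CauchySeq fun n => (A n).entry k l := by
    intro k l
    rw [Metric.cauchySeq_iff] at hA ⊢
    intro ε hε
    obtain ⟨N, hN⟩ := hA ε hε
    refine ⟨N, fun m hm n hn => lt_of_le_of_lt ?_ (hN m hm n hn)⟩
    rw [dist_eq_norm, dist_eq_norm]
    exact norm_entry_le (A m - A n) k l
  choose B hB using fun k l => cauchySeq_tendsto_of_complete (hent k l)
  have key : ∀ ε > 0, ∃ N, ∀ n ≥ N,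
      schurENorm (anisoWeight α ν) ((A n).entry - B) ≤ ENNReal.ofReal ε := by
    intro ε hε
    obtain ⟨N, hN⟩ := Metric.cauchySeq_iff.1 hA ε hε
    refine ⟨N, fun n hn => ?_⟩
    refine schurENorm_le_of_tendsto (F := Filter.atTop)
      (A := fun m => (A n).entry - (A m).entry) (fun k l => (hB k l).const_sub _) ?_
    filter_upwards [Filter.eventually_ge_atTop N] with m hm
    have := (hN n hn m hm).le
    rw [dist_eq_norm, norm_le_iff _ hε.le] at this
    exact this
  obtain ⟨N, hN⟩ := key 1 one_pos
  have hBfin : schurENorm (anisoWeight α ν) B < ∞ := by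
    have : B = (A N).entry + -((A N).entry - B) := by abel
    rw [this]
    refine (schurENorm_add_le _ _).trans_lt (ENNReal.add_lt_top.2 ⟨(A N).finite, ?_⟩)
    rw [schurENorm_neg]
    exact (hN N le_rfl).trans_lt ENNReal.ofReal_lt_top
  refine ⟨⟨B, hBfin⟩, Metric.tendsto_atTop.2 fun ε hε => ?_⟩
  obtain ⟨N, hN⟩ := key (ε / 2) (half_pos hε)
  refine ⟨N, fun n hn => lt_of_le_of_lt ?_ (half_lt_self hε)⟩
  rw [dist_eq_norm, norm_le_iff _ (half_pos hε).le]
  exact hN n hn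

/-- The embedding into the bounded operators on `ℓ²(X; H)`. -/
noncomputable def toOperatorHom : AnisoSchur X H ν α →⋆ₐ[ℂ] (EllTwo X H →L[ℂ] EllTwo X H) where
  toFun := toOperator
  map_one' := toOperator_one
  map_mul' := toOperator_mul
  map_zero' := toOperator_zero
  map_add' := toOperator_add
  commutes' c := by
    rw [Algebra.algebraMap_eq_smul_one, Algebra.algebraMap_eq_smul_one, toOperator_smul,
      toOperator_one]
  map_star' := toOperator_star

theorem exists_of_norm_entry_le (A : AnisoSchur X H ν α) (B : OpMatrix X H)
    (h : ∀ k l, ‖B k l‖ ≤ ‖A.entry k l‖) :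
    ∃ B' : AnisoSchur X H ν α, B'.entry = B ∧ ‖B'‖ ≤ ‖A‖ :=
  ⟨⟨B, (schurENorm_mono h).trans_lt A.finite⟩, rfl,
    ENNReal.toReal_mono A.finite.ne (schurENorm_mono h)⟩

end AnisoSchur

/-! ### Numerical recursions -/

/-- If N stayed above 1, the recursion would iterate to C N_m ≤ (σ^m C N_0)^(2^m). The base tends to
0 however large N_0 is, whereas C N_m ≥ 1. -/
theorem exists_lt_one_of_sq_recursion {N : ℕ → ℝ} {σ C : ℝ} (hσ0 : 0 ≤ σ) (hσ1 : σ < 1)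
    (hC : 1 ≤ C) (h : ∀ m, 1 ≤ N m → N (m + 1) ≤ C * (σ ^ 2) ^ 2 ^ m * N m ^ 2) :
    ∃ m, N m < 1 := by
  by_contra! hN
  have hM : ∀ m, C * N m ≤ (σ ^ m * (C * N 0)) ^ 2 ^ m := by
    intro m
    induction m with
    | zero => simp
    | succ m ih =>
      have h0 : 0 ≤ C * N m := by have := hN m; positivity
      calc C * N (m + 1) ≤ C * (C * (σ ^ 2) ^ 2 ^ m * N m ^ 2) := by
            gcongr; exact h m (hN m)
        _ = (σ ^ 2 ^ m) ^ 2 * (C * N m) ^ 2 := by ring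
        _ ≤ (σ ^ 2 ^ m) ^ 2 * ((σ ^ m * (C * N 0)) ^ 2 ^ m) ^ 2 := by gcongr
        _ = (σ ^ (m + 1) * (C * N 0)) ^ 2 ^ (m + 1) := by
            rw [pow_succ σ m, pow_succ 2 m, pow_mul, ← mul_pow, ← mul_pow]
            congr 2
            ring
  have hlim : Filter.Tendsto (fun m => σ ^ m * (C * N 0)) Filter.atTop (𝓝 0) := by
    simpa using (tendsto_pow_atTop_nhds_zero_of_lt_one hσ0 hσ1).mul_const (C * N 0)
  obtain ⟨m, hm⟩ := (hlim.eventually (gt_mem_nhds one_pos)).exists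
  have h0 : 0 ≤ σ ^ m * (C * N 0) := by have := hN 0; positivity
  have h1 : C * N m < 1 := (hM m).trans_lt (pow_lt_one₀ h0 hm (by positivity))
  have h2 : 1 ≤ C * N m := one_le_mul_of_one_le_of_one_le hC (hN m)
  exact absurd h1 (not_lt.2 h2)

/-- The free parameter s is tuned to m so that both coefficients are O(τ^(2^m)) for one τ < 1; this
reduces the claim to `exists_lt_one_of_sq_recursion`. -/
theorem exists_lt_one_of_interpolation {N : ℕ → ℝ} {q K δ : ℝ} {D : ℕ} (hq0 : 0 < q)
    (hq1 : q < 1) (hK : 0 ≤ K) (hδ : 0 < δ)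
    (hN : ∀ m s : ℕ, N (m + 1) ≤
      K * (1 + s) ^ D * q ^ 2 ^ m * N m + (2 / (1 + s)) ^ δ * N m ^ 2) :
    ∃ m, N m < 1 := by
  -- With x = t^(2^m) and 1 + s comparable to 1/x, the factor q^(2^m) = x^(2(D+1)) absorbs (1+s)^D
  -- and still leaves a power of x.
  set t : ℝ := q ^ (1 / (2 * (D + 1) : ℝ)) with ht
  have ht0 : 0 < t := Real.rpow_pos_of_pos hq0 _
  have ht1 : t < 1 := Real.rpow_lt_one hq0.le hq1 (by positivity)
  have htq : t ^ (2 * (D + 1)) = q := by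
    rw [ht, ← Real.rpow_natCast, ← Real.rpow_mul hq0.le]
    push_cast
    rw [one_div_mul_cancel (by positivity), Real.rpow_one]
  have htδ0 : 0 < t ^ δ := Real.rpow_pos_of_pos ht0 _
  have htδ1 : t ^ δ < 1 := Real.rpow_lt_one ht0.le ht1 hδ
  set τ := max t (t ^ δ) with hτ
  have hτ0 : 0 ≤ τ := ht0.le.trans (le_max_left _ _)
  have hτ1 : τ < 1 := max_lt ht1 htδ1
  refine exists_lt_one_of_sq_recursion (σ := √τ) (C := K * 2 ^ (D + 1) + 2 ^ δ)
    (Real.sqrt_nonneg _) (by rw [Real.sqrt_lt' one_pos]; simpa using hτ1)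
    (le_add_of_nonneg_of_le (by positivity) (Real.one_le_rpow one_le_two hδ.le)) ?_
  intro m hm
  rw [Real.sq_sqrt hτ0]
  set x := t ^ 2 ^ m with hx
  have hx0 : 0 < x := by positivity
  have hx1 : x ≤ 1 := pow_le_one₀ ht0.le ht1.le
  have hT1 : 1 ≤ x⁻¹ := (one_le_inv₀ hx0).2 hx1
  set s := ⌊x⁻¹⌋₊
  have hs1 : x⁻¹ ≤ 1 + s := by
    have := (Nat.lt_floor_add_one x⁻¹).le
    linarith
  have hs2 : (1 + s : ℝ) ≤ 2 * x⁻¹ := by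
    have := Nat.floor_le (zero_le_one.trans hT1)
    linarith
  have hxτ : x ≤ τ ^ 2 ^ m := pow_le_pow_left₀ ht0.le (le_max_left _ _) _
  have hxδ : x ^ δ ≤ τ ^ 2 ^ m := by
    rw [hx, ← Real.rpow_natCast, ← Real.rpow_mul ht0.le, mul_comm, Real.rpow_mul ht0.le,
      Real.rpow_natCast]
    exact pow_le_pow_left₀ htδ0.le (le_max_right _ _) _
  have hqx : q ^ 2 ^ m = (x ^ (D + 1)) * x ^ (D + 1) := by
    rw [← htq, hx]; ring
  have e1 : (1 + s : ℝ) ^ D * q ^ 2 ^ m ≤ 2 ^ (D + 1) * τ ^ 2 ^ m := by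
    calc (1 + s : ℝ) ^ D * q ^ 2 ^ m ≤ (1 + s : ℝ) ^ (D + 1) * q ^ 2 ^ m := by
          gcongr
          · linarith
          · exact Nat.le_succ D
      _ ≤ (2 * x⁻¹) ^ (D + 1) * q ^ 2 ^ m := by gcongr
      _ = 2 ^ (D + 1) * x ^ (D + 1) := by
          rw [hqx, mul_pow, inv_pow]; field_simp
      _ ≤ 2 ^ (D + 1) * x := by
          gcongr; exact pow_le_of_le_one hx0.le hx1 (Nat.succ_ne_zero D)
      _ ≤ _ := by gcongr
  have e2 : (2 / (1 + s : ℝ)) ^ δ ≤ 2 ^ δ * τ ^ 2 ^ m := by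
    calc (2 / (1 + s : ℝ)) ^ δ ≤ (2 * x) ^ δ := by
          gcongr
          rw [div_le_iff₀ (by positivity), mul_assoc]
          have := mul_le_mul_of_nonneg_left hs1 hx0.le
          rw [mul_inv_cancel₀ hx0.ne'] at this
          linarith
      _ = 2 ^ δ * x ^ δ := Real.mul_rpow zero_le_two hx0.le
      _ ≤ _ := by gcongr
  -- The assumption N m ≥ 1 turns the linear term into a quadratic one.
  have hm2 : N m ≤ N m ^ 2 := le_self_pow₀ hm two_ne_zero
  calc N (m + 1) ≤ K * ((1 + s) ^ D * q ^ 2 ^ m) * N m + (2 / (1 + s)) ^ δ * N m ^ 2 := by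
        rw [← mul_assoc]; exact hN m s
    _ ≤ K * (2 ^ (D + 1) * τ ^ 2 ^ m) * N m ^ 2 + (2 ^ δ * τ ^ 2 ^ m) * N m ^ 2 := by
        have : 0 ≤ N m := zero_le_one.trans hm
        gcongr
    _ = _ := by ring

/-! ### The product estimate split at distance s from the diagonal -/

section Interpolation

variable {d : ℕ} {X : Set (EuclideanSpace ℝ (Fin d))} {H : Type*}
  [NormedAddCommGroup H] [InnerProductSpace ℂ H]

open Classical in
-- Each row and column of the band has at most c positions, each contributing at most K a.
theorem kernelSchur_truncation_le (p : Seminorm ℝ (EuclideanSpace ℝ (Fin d)))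
    {u : EuclideanSpace ℝ (Fin d) → ℝ} {s K c : ℝ} (A : OpMatrix X H) {a : ℝ}
    (hK0 : 0 ≤ K) (hA : ∀ k l, ‖A k l‖ ≤ a) (ha : 0 ≤ a) (hu : ∀ x, p x ≤ s → u x ≤ K)
    (hcard : ∀ (k : X) (F : Finset X),
      (∀ l ∈ F, p ((k : EuclideanSpace ℝ (Fin d)) - l) ≤ s) → (F.card : ℝ) ≤ c) :
    kernelSchur (fun k l : X => if p ((k : EuclideanSpace ℝ (Fin d)) - l) ≤ s then
      ‖A k l‖ₑ * ENNReal.ofReal (u (k - l)) else 0) ≤ ENNReal.ofReal (c * K * a) := by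
  have hterm : ∀ k l : X, p ((k : EuclideanSpace ℝ (Fin d)) - l) ≤ s →
      ‖A k l‖ₑ * ENNReal.ofReal (u (k - l)) ≤ ENNReal.ofReal (K * a) := by
    intro k l h
    rw [← ofReal_norm, ← ENNReal.ofReal_mul (norm_nonneg _), mul_comm K]
    refine ENNReal.ofReal_le_ofReal ?_
    exact (mul_le_mul_of_nonneg_left (hu _ h) (norm_nonneg _)).trans
      (mul_le_mul_of_nonneg_right (hA k l) hK0)
  have hfin : ∀ F : Finset X, (F.card : ℝ) ≤ c → ∀ g : X → ℝ≥0∞,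
      (∀ i ∈ F, g i ≤ ENNReal.ofReal (K * a)) → ∑ i ∈ F, g i ≤ ENNReal.ofReal (c * K * a) := by
    intro F hF g hg
    refine (Finset.sum_le_card_nsmul F g _ hg).trans ?_
    rw [nsmul_eq_mul, ← ENNReal.ofReal_natCast, ← ENNReal.ofReal_mul (Nat.cast_nonneg _), mul_assoc]
    exact ENNReal.ofReal_le_ofReal (by gcongr)
  refine kernelSchur_le (fun k => ?_) (fun l => ?_)
  · rw [ENNReal.tsum_eq_iSup_sum]
    refine iSup_le fun F => ?_
    rw [← Finset.sum_filter]
    exact hfin _ (hcard k _ fun l hl => (Finset.mem_filter.1 hl).2) _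
      fun l hl => hterm k l (Finset.mem_filter.1 hl).2
  · rw [ENNReal.tsum_eq_iSup_sum]
    refine iSup_le fun F => ?_
    rw [← Finset.sum_filter]
    exact hfin _ (hcard l _ fun k hk => by rw [map_sub_rev]; exact (Finset.mem_filter.1 hk).2) _
      fun k hk => hterm k l (Finset.mem_filter.1 hk).2

open Classical in
-- For each intermediate index n, either k - n or n - l lies in the ball of radius s and a band
-- kernel takes over that factor, or both lie outside and the gain η applies.
theorem schurENorm_matrixMul_le_interpolation (p : Seminorm ℝ (EuclideanSpace ℝ (Fin d)))
    {u : EuclideanSpace ℝ (Fin d) → ℝ} (hw : IsSubmultWeight u) {s K c η : ℝ}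
    (hK0 : 0 ≤ K) (hη : 0 ≤ η) (hu : ∀ x, p x ≤ s → u x ≤ K)
    (hcard : ∀ (k : X) (F : Finset X),
      (∀ l ∈ F, p ((k : EuclideanSpace ℝ (Fin d)) - l) ≤ s) → (F.card : ℝ) ≤ c)
    (hsub : ∀ x y, s ≤ p x → s ≤ p y → u (x + y) ≤ η * (u x * u y))
    (A B : OpMatrix X H) {a b : ℝ} (hA : ∀ k l, ‖A k l‖ ≤ a) (ha : 0 ≤ a)
    (hB : ∀ k l, ‖B k l‖ ≤ b) (hb : 0 ≤ b) :
    schurENorm u (matrixMul A B) ≤ ENNReal.ofReal (c * K * a) * schurENorm u B +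
      schurENorm u A * ENNReal.ofReal (c * K * b) +
      ENNReal.ofReal η * (schurENorm u A * schurENorm u B) := by
  set κ : OpMatrix X H → X → X → ℝ≥0∞ := fun A k l => ‖A k l‖ₑ * ENNReal.ofReal (u (k - l))
  set T : OpMatrix X H → X → X → ℝ≥0∞ := fun A k l =>
    if p ((k : EuclideanSpace ℝ (Fin d)) - l) ≤ s then κ A k l else 0
  have hκ : ∀ A : OpMatrix X H, schurENorm u A = kernelSchur (κ A) :=
    fun A => schurENorm_eq_kernelSchur u A
  have u0 : ∀ x, 0 ≤ u x := fun x => zero_le_one.trans (hw.one_le x)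
  have hpt : ∀ k l n : X, ‖A k n‖ₑ * ‖B n l‖ₑ * ENNReal.ofReal (u (k - l)) ≤
      (T A k n * κ B n l + κ A k n * T B n l) + ENNReal.ofReal η * (κ A k n * κ B n l) := by
    intro k l n
    have hkl : (k : EuclideanSpace ℝ (Fin d)) - l = (k - n) + (n - l) :=
      (sub_add_sub_cancel _ _ _).symm
    have h1 : ENNReal.ofReal (u (k - l)) ≤
        ENNReal.ofReal (u (k - n)) * ENNReal.ofReal (u (n - l)) := by
      rw [← ENNReal.ofReal_mul (u0 _), hkl]
      exact ENNReal.ofReal_le_ofReal (hw.map_add_le _ _)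
    have h2 : ‖A k n‖ₑ * ‖B n l‖ₑ * ENNReal.ofReal (u (k - l)) ≤ κ A k n * κ B n l := by
      calc _ ≤ ‖A k n‖ₑ * ‖B n l‖ₑ *
            (ENNReal.ofReal (u (k - n)) * ENNReal.ofReal (u (n - l))) := mul_le_mul_right h1 _
        _ = _ := by simp only [κ]; ring
    by_cases hx : p ((k : EuclideanSpace ℝ (Fin d)) - n) ≤ s
    · have : T A k n = κ A k n := if_pos hx
      rw [this]
      exact h2.trans (le_self_add.trans le_self_add)
    by_cases hy : p ((n : EuclideanSpace ℝ (Fin d)) - l) ≤ s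
    · have : T B n l = κ B n l := if_pos hy
      rw [this]
      exact h2.trans (le_add_self.trans le_self_add)
    refine le_trans ?_ le_add_self
    have h3 : ENNReal.ofReal (u (k - l)) ≤
        ENNReal.ofReal η * (ENNReal.ofReal (u (k - n)) * ENNReal.ofReal (u (n - l))) := by
      rw [← ENNReal.ofReal_mul (u0 _), ← ENNReal.ofReal_mul hη, hkl]
      exact ENNReal.ofReal_le_ofReal (hsub _ _ (not_le.1 hx).le (not_le.1 hy).le)
    calc _ ≤ ‖A k n‖ₑ * ‖B n l‖ₑ * (ENNReal.ofReal η *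
            (ENNReal.ofReal (u (k - n)) * ENNReal.ofReal (u (n - l)))) := mul_le_mul_right h3 _
      _ = _ := by simp only [κ]; ring
  have hTA : kernelSchur (T A) ≤ ENNReal.ofReal (c * K * a) :=
    kernelSchur_truncation_le p A hK0 hA ha hu hcard
  have hTB : kernelSchur (T B) ≤ ENNReal.ofReal (c * K * b) :=
    kernelSchur_truncation_le p B hK0 hB hb hu hcard
  have hle : ∀ k l : X, κ (matrixMul A B) k l ≤
      (∑' n, T A k n * κ B n l + ∑' n, κ A k n * T B n l) +
        ENNReal.ofReal η * ∑' n, κ A k n * κ B n l := by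
    intro k l
    calc κ (matrixMul A B) k l
        ≤ (∑' n, ‖A k n‖ₑ * ‖B n l‖ₑ) * ENNReal.ofReal (u (k - l)) := by
          refine mul_le_mul_left ?_ _
          refine (enorm_tsum_le_tsum_enorm (f := fun n => A k n * B n l)).trans ?_
          exact ENNReal.tsum_le_tsum fun n => (A k n).opENorm_comp_le (B n l)
      _ ≤ _ := by
          rw [← ENNReal.tsum_mul_right, ← ENNReal.tsum_add, ← ENNReal.tsum_mul_left,
            ← ENNReal.tsum_add]
          exact ENNReal.tsum_le_tsum fun n => hpt k l n
  rw [hκ, hκ, hκ]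
  refine (kernelSchur_mono hle).trans ((kernelSchur_add_le _ _).trans ?_)
  refine add_le_add ((kernelSchur_add_le _ _).trans (add_le_add ?_ ?_))
    ((kernelSchur_const_mul_le _ _).trans ?_)
  · exact (kernelSchur_comp_le _ _).trans (mul_le_mul_left hTA _)
  · exact (kernelSchur_comp_le _ _).trans (mul_le_mul_right hTB _)
  · exact mul_le_mul_right (kernelSchur_comp_le _ _) _

end Interpolation

/-! ### Truncated weights and invertibility of 1 - A -/

/-- A decreasing sequence of weights `u j`, each equivalent to `w`, which grow at most polynomially
and are submultiplicative with a gain on balls of radius increasing with `j`; the radii are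
measured by a seminorm `p` whose balls contain polynomially many points of `X`. -/
structure IsWeightTruncation {d : ℕ} (X : Set (EuclideanSpace ℝ (Fin d)))
    (w : EuclideanSpace ℝ (Fin d) → ℝ) (p : Seminorm ℝ (EuclideanSpace ℝ (Fin d)))
    (u : ℕ → EuclideanSpace ℝ (Fin d) → ℝ) (K δ : ℝ) (D : ℕ) : Prop where
  const_nonneg : 0 ≤ K
  exponent_pos : 0 < δ
  submult : ∀ j, IsSubmultWeight (u j)
  succ_le : ∀ j x, u (j + 1) x ≤ u j x
  le_weight : ∀ j x, u j x ≤ w x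
  weight_le : ∀ j, ∃ M : ℝ, ∀ x, w x ≤ M * u j x
  bound : ∀ s : ℕ, ∀ᶠ j in Filter.atTop, ∀ x, p x ≤ s → u j x ≤ K * (1 + s) ^ D
  gain : ∀ s : ℕ, ∀ᶠ j in Filter.atTop, ∀ x y, s ≤ p x → s ≤ p y →
    u j (x + y) ≤ (2 / (1 + s)) ^ δ * (u j x * u j y)
  card_le : ∀ (s : ℕ) (k : X) (F : Finset X),
    (∀ l ∈ F, p ((k : EuclideanSpace ℝ (Fin d)) - l) ≤ s) → (F.card : ℝ) ≤ K * (1 + s) ^ D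

section SchurMono

variable {d : ℕ} {X : Set (EuclideanSpace ℝ (Fin d))} {H : Type*}
  [NormedAddCommGroup H] [InnerProductSpace ℂ H] {u w : EuclideanSpace ℝ (Fin d) → ℝ}

theorem schurENorm_mono_weight (h : ∀ x, u x ≤ w x) (A : OpMatrix X H) :
    schurENorm u A ≤ schurENorm w A := by
  rw [schurENorm_eq_kernelSchur, schurENorm_eq_kernelSchur]
  exact kernelSchur_mono fun k l => mul_le_mul_right (ENNReal.ofReal_le_ofReal (h _)) _

theorem schurENorm_le_const_mul {M : ℝ} (hM : 0 ≤ M) (h : ∀ x, w x ≤ M * u x)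
    (A : OpMatrix X H) : schurENorm w A ≤ ENNReal.ofReal M * schurENorm u A := by
  rw [schurENorm_eq_kernelSchur, schurENorm_eq_kernelSchur]
  refine (kernelSchur_mono fun k l => ?_).trans (kernelSchur_const_mul_le _ _)
  calc _ ≤ ‖A k l‖ₑ * ENNReal.ofReal (M * u (k - l)) :=
        mul_le_mul_right (ENNReal.ofReal_le_ofReal (h _)) _
    _ = _ := by rw [ENNReal.ofReal_mul hM]; ring

end SchurMono

namespace AnisoSchur

variable {d : ℕ} {X : Set (EuclideanSpace ℝ (Fin d))} {H : Type*}
  [NormedAddCommGroup H] [InnerProductSpace ℂ H] [CompleteSpace H]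
  {ν : EuclideanSpace ℝ (Fin d) → ℝ} {α : Fin d → ℕ}
  [hw : Fact (IsSubmultWeight (anisoWeight α ν))]

theorem toOperator_pow (A : AnisoSchur X H ν α) (n : ℕ) :
    (A ^ n).toOperator = A.toOperator ^ n := by
  induction n with
  | zero => rw [pow_zero, pow_zero, toOperator_one]
  | succ n ih => rw [pow_succ, pow_succ, toOperator_mul, ih]

theorem schurENorm_pow_succ_le {u : EuclideanSpace ℝ (Fin d) → ℝ} (hu : IsSubmultWeight u)
    (A : AnisoSchur X H ν α) (n : ℕ) :
    schurENorm u (A ^ (n + 1)).entry ≤ schurENorm u A.entry ^ (n + 1) := by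
  induction n with
  | zero => simp
  | succ n ih =>
    rw [pow_succ A, mul_entry, pow_succ (schurENorm u A.entry)]
    exact (schurENorm_matrixMul_le hu _ _).trans (mul_le_mul_left ih _)

variable {p : Seminorm ℝ (EuclideanSpace ℝ (Fin d))}
  {u : ℕ → EuclideanSpace ℝ (Fin d) → ℝ} {K δ : ℝ} {D : ℕ}

theorem schurENorm_truncation_ne_top (hT : IsWeightTruncation X (anisoWeight α ν) p u K δ D)
    (A : AnisoSchur X H ν α) (j : ℕ) : schurENorm (u j) A.entry ≠ ∞ :=
  ne_top_of_le_ne_top A.finite.ne (schurENorm_mono_weight (hT.le_weight j) _)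

theorem tendsto_schurENorm_truncation
    (hT : IsWeightTruncation X (anisoWeight α ν) p u K δ D) (A : AnisoSchur X H ν α) :
    Filter.Tendsto (fun j => (schurENorm (u j) A.entry).toReal) Filter.atTop
      (𝓝 (⨅ j, (schurENorm (u j) A.entry).toReal)) := by
  refine tendsto_atTop_ciInf (antitone_nat_of_succ_le fun j => ?_)
    ⟨0, by rintro _ ⟨j, rfl⟩; exact ENNReal.toReal_nonneg⟩
  exact ENNReal.toReal_mono (schurENorm_truncation_ne_top hT A j)
    (schurENorm_mono_weight (hT.succ_le j) _)

theorem iInf_truncation_mul_self_le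
    (hT : IsWeightTruncation X (anisoWeight α ν) p u K δ D) (A : AnisoSchur X H ν α) (s : ℕ) :
    (⨅ j, (schurENorm (u j) (A * A).entry).toReal) ≤
      2 * K ^ 2 * (1 + s) ^ (2 * D) * ‖A.toOperator‖ *
        (⨅ j, (schurENorm (u j) A.entry).toReal) +
      (2 / (1 + s)) ^ δ * (⨅ j, (schurENorm (u j) A.entry).toReal) ^ 2 := by
  have hK := hT.const_nonneg
  have h1 := tendsto_schurENorm_truncation hT (A * A)
  have h2 := tendsto_schurENorm_truncation hT A
  -- The estimate for `u j` holds only once j exceeds a threshold depending on s. Letting j tend to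
  -- infinity first removes it and leaves s free.
  refine le_of_tendsto_of_tendsto h1 ((h2.const_mul _).add ((h2.pow 2).const_mul _)) ?_
  filter_upwards [hT.bound s, hT.gain s] with j hb hg
  have hη : (0 : ℝ) ≤ (2 / (1 + s)) ^ δ := by positivity
  have hc : (0 : ℝ) ≤ K * (1 + s) ^ D := by positivity
  have key := schurENorm_matrixMul_le_interpolation p (hT.submult j) hc hη hb (hT.card_le s) hg
    A.entry A.entry A.norm_entry_le_toOperator (norm_nonneg _) A.norm_entry_le_toOperator
    (norm_nonneg _)
  have hA := schurENorm_truncation_ne_top hT A j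
  set N := schurENorm (u j) A.entry
  have key' := ENNReal.toReal_mono (by finiteness) key
  rw [ENNReal.toReal_add (by finiteness) (by finiteness),
    ENNReal.toReal_add (by finiteness) (by finiteness), ENNReal.toReal_mul, ENNReal.toReal_mul,
    ENNReal.toReal_mul, ENNReal.toReal_mul, ENNReal.toReal_ofReal (by positivity),
    ENNReal.toReal_ofReal hη] at key'
  rw [mul_entry]
  refine key'.trans_eq ?_
  ring

/-- The heart of the proof: repeated squaring brings the limiting norm of A^(2^m) below 1, hence one
`u j`-norm too; equivalence of weights then sends its powers to 0 in the original norm. -/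
theorem isUnit_one_sub_of_norm_toOperator_lt_one
    (hT : IsWeightTruncation X (anisoWeight α ν) p u K δ D) (A : AnisoSchur X H ν α)
    (hA : ‖A.toOperator‖ < 1) : IsUnit (1 - A) := by
  have hbdd : ∀ B : AnisoSchur X H ν α,
      BddBelow (Set.range fun j => (schurENorm (u j) B.entry).toReal) :=
    fun B => ⟨0, by rintro _ ⟨j, rfl⟩; exact ENNReal.toReal_nonneg⟩
  -- The recursion needs q > 0, and the operator norm may vanish.
  set q : ℝ := max ‖A.toOperator‖ (1 / 2) with hq
  have hpow : ∀ n : ℕ, 0 < n → ‖(A ^ n).toOperator‖ ≤ q ^ n := fun n hn => by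
    rw [toOperator_pow]
    exact (norm_pow_le' _ hn).trans (pow_le_pow_left₀ (norm_nonneg _) (le_max_left _ _) n)
  obtain ⟨m, hm⟩ : ∃ m, (⨅ j, (schurENorm (u j) (A ^ 2 ^ m).entry).toReal) < 1 := by
    refine exists_lt_one_of_interpolation (q := q) (K := 2 * K ^ 2) (δ := δ) (D := 2 * D)
      (lt_max_of_lt_right (by norm_num)) (max_lt hA (by norm_num)) (by positivity)
      hT.exponent_pos fun m s => ?_
    rw [pow_succ 2 m, pow_mul, sq]
    refine (iInf_truncation_mul_self_le hT (A ^ 2 ^ m) s).trans ?_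
    have h0 : 0 ≤ ⨅ j, (schurENorm (u j) (A ^ 2 ^ m).entry).toReal :=
      Real.iInf_nonneg fun j => ENNReal.toReal_nonneg
    gcongr
    exact hpow _ (by positivity)
  obtain ⟨j, hj⟩ := exists_lt_of_ciInf_lt hm
  set B := A ^ 2 ^ m with hB
  obtain ⟨M, hM⟩ := hT.weight_le j
  have hM' : ∀ x, anisoWeight α ν x ≤ max M 0 * u j x := fun x =>
    (hM x).trans (mul_le_mul_of_nonneg_right (le_max_left _ _)
      (zero_le_one.trans ((hT.submult j).one_le x)))
  have hBn : ∀ n, ‖B ^ (n + 1)‖ ≤ max M 0 * (schurENorm (u j) B.entry).toReal ^ (n + 1) := by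
    intro n
    have hfin := schurENorm_truncation_ne_top hT B j
    have h1 := (schurENorm_le_const_mul (le_max_right M 0) hM' (B ^ (n + 1)).entry).trans
      (mul_le_mul_right (schurENorm_pow_succ_le (hT.submult j) B n) _)
    have h2 := ENNReal.toReal_mono (by finiteness) h1
    rwa [ENNReal.toReal_mul, ENNReal.toReal_pow, ENNReal.toReal_ofReal (le_max_right _ _)] at h2
  have hlim : Filter.Tendsto
      (fun n : ℕ => max M 0 * (schurENorm (u j) B.entry).toReal ^ (n + 1)) Filter.atTop (𝓝 0) := by
    simpa using ((Filter.tendsto_add_atTop_iff_nat 1).2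
      (tendsto_pow_atTop_nhds_zero_of_lt_one ENNReal.toReal_nonneg hj)).const_mul (max M 0)
  obtain ⟨n, hn⟩ := (hlim.eventually (gt_mem_nhds one_pos)).exists
  have hu : IsUnit (1 - B ^ (n + 1)) := isUnit_one_sub_of_norm_lt_one ((hBn n).trans_lt hn)
  -- 1 - A is a factor of 1 - A^(2^m (n+1)) through a geometric sum, with which it commutes.
  rw [hB, ← pow_mul, ← mul_neg_geom_sum] at hu
  refine ((Commute.isUnit_mul_iff ?_).1 hu).1
  rw [commute_iff_eq, mul_neg_geom_sum, geom_sum_mul_neg]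

end AnisoSchur

/-! ### Inverse-closedness and symmetry from the C*-algebra -/

section CStar

variable {A B : Type*} [Ring A] [Algebra ℂ A] [Star A] [CStarAlgebra B]

/-- The spectrum of b*b lies in (0, ‖b*b‖], so after scaling that of the difference lies in [0,1);
for a self-adjoint element the norm is the spectral radius. -/
theorem CStarAlgebra.norm_one_sub_smul_star_mul_self_lt_one [Nontrivial B] {b : B}
    (hb : IsUnit b) :
    ‖1 - ((‖star b * b‖⁻¹ : ℝ) : ℂ) • (star b * b)‖ < 1 := by
  set T := star b * b with hTdef
  have hTu : IsUnit T := hb.star.mul hb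
  have hTsa : IsSelfAdjoint T := IsSelfAdjoint.star_mul_self b
  have hT0 : 0 < ‖T‖ := norm_pos_iff.2 hTu.ne_zero
  set r : ℝ := ‖T‖⁻¹ with hr
  have hr0 : 0 < r := inv_pos.2 hT0
  have hS : IsSelfAdjoint (1 - (r : ℂ) • T) :=
    (IsSelfAdjoint.one B).sub (IsSelfAdjoint.smul (r := (r : ℂ)) (Complex.conj_ofReal r) hTsa)
  obtain ⟨z, hz, hzn⟩ := spectrum.exists_nnnorm_eq_spectralRadius (1 - (r : ℂ) • T)
  rw [hS.spectralRadius_eq_nnnorm] at hzn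
  have hzn' : ‖z‖ = ‖1 - (r : ℂ) • T‖ := congrArg NNReal.toReal (ENNReal.coe_injective hzn)
  rw [← hzn']
  have h1 : (1 : B) = algebraMap ℂ B 1 := (map_one _).symm
  rw [h1, ← spectrum.singleton_sub_eq] at hz
  obtain ⟨_, rfl, y, hy, rfl⟩ := hz
  have hrc : (r : ℂ) ≠ 0 := by exact_mod_cast hr0.ne'
  have hy' : y ∈ spectrum ℂ ((Units.mk0 (r : ℂ) hrc) • T) := hy
  rw [spectrum.unit_smul_eq_smul] at hy'
  obtain ⟨t, ht, rfl⟩ := hy'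
  have htre := hTsa.mem_spectrum_eq_re ht
  have htR : t.re ∈ spectrum ℝ T := by
    rw [← spectrum.algebraMap_mem_iff ℂ]
    rw [htre] at ht
    exact ht
  have ht0 : 0 ≤ t.re := spectrum_star_mul_self_nonneg _ htR
  have htne : t.re ≠ 0 := fun h => spectrum.zero_notMem ℝ hTu (h ▸ htR)
  have htle : t.re ≤ ‖T‖ := by
    have := spectrum.norm_le_norm_of_mem ht
    exact (Complex.re_le_norm t).trans this
  have hval : ((1 : ℂ) - (Units.mk0 (r : ℂ) hrc) • t) = ((1 - r * t.re : ℝ) : ℂ) := by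
    rw [Units.smul_mk0, smul_eq_mul, htre]; simp
  have hrt : r * t.re ≤ 1 := by
    rw [hr, inv_mul_le_iff₀ hT0]; simpa using htle
  have hrt' : 0 < r * t.re := mul_pos hr0 (lt_of_le_of_ne ht0 htne.symm)
  change ‖(1 : ℂ) - (Units.mk0 (r : ℂ) hrc) • t‖ < 1
  rw [hval, Complex.norm_real, Real.norm_eq_abs, abs_lt]
  constructor <;> linarith

/-- The hypothesis applied to 1 - r a*a, with r = 1/‖φ(a)*φ(a)‖, makes r a*a a unit of A. A left
inverse c of it gives the left inverse c r a* of a, whose image must be b. -/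
theorem isInverseClosed_of_isUnit_one_sub (φ : A →⋆ₐ[ℂ] B)
    (h : ∀ a, ‖φ a‖ < 1 → IsUnit (1 - a)) : IsInverseClosed φ := by
  intro a b hab hba
  rcases subsingleton_or_nontrivial B with hB | hB
  · exact ⟨0, Subsingleton.elim _ _⟩
  have hu : IsUnit (φ a) := ⟨⟨φ a, b, hab, hba⟩, rfl⟩
  have hT0 : 0 < ‖star (φ a) * φ a‖ := norm_pos_iff.2 (hu.star.mul hu).ne_zero
  set r : ℝ := ‖star (φ a) * φ a‖⁻¹ with hr
  have hrc : (r : ℂ) ≠ 0 := by exact_mod_cast (inv_pos.2 hT0).ne'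
  have h1 := h (1 - (r : ℂ) • (star a * a)) (by
    rw [map_sub, map_one, map_smul, map_mul, map_star]
    exact CStarAlgebra.norm_one_sub_smul_star_mul_self_lt_one hu)
  rw [sub_sub_cancel] at h1
  obtain ⟨c, hc⟩ := h1.exists_left_inv
  refine ⟨c * ((r : ℂ) • star a), ?_⟩
  have h2 : φ (c * ((r : ℂ) • star a)) * φ a = 1 := by
    rw [← map_mul, mul_assoc, smul_mul_assoc, hc, map_one]
  exact left_inv_eq_right_inv h2 hab

/-- Inverse-closedness and injectivity put the spectrum in A inside the spectrum in B, where a*a is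
positive. -/
theorem isSymmetricStarAlgebra_of_isInverseClosed {φ : A →⋆ₐ[ℂ] B} (hinj : Function.Injective φ)
    (h : IsInverseClosed φ) : IsSymmetricStarAlgebra A := by
  intro a z hz
  have hz' : z ∈ spectrum ℂ (star (φ a) * φ a) := by
    intro hu
    obtain ⟨v, hv⟩ := hu
    apply hz
    have hφ : φ (algebraMap ℂ A z - star a * a) = v := by
      rw [hv, map_sub, map_mul, map_star, AlgHomClass.commutes]
    obtain ⟨c, hc⟩ := h (algebraMap ℂ A z - star a * a) (↑v⁻¹) (by rw [hφ]; simp)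
      (by rw [hφ]; simp)
    refine ⟨⟨algebraMap ℂ A z - star a * a, c, hinj ?_, hinj ?_⟩, rfl⟩
    · rw [map_mul, hc, hφ, map_one]; simp
    · rw [map_mul, hc, hφ, map_one]; simp
  have hsa : IsSelfAdjoint (star (φ a) * φ a) := IsSelfAdjoint.star_mul_self _
  have hre := hsa.mem_spectrum_eq_re hz'
  have hR : z.re ∈ spectrum ℝ (star (φ a) * φ a) := by
    rw [← spectrum.algebraMap_mem_iff ℂ]
    rw [hre] at hz'
    exact hz'
  exact ⟨spectrum_star_mul_self_nonneg _ hR, by rw [hre]; simp⟩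

end CStar

/-! ### Concave functions on the half-line -/

section Concave

variable {σ : ℝ → ℝ}

/-- Increments of a concave function decrease: x + h and y are convex combinations of x and y + h
with the two coefficients exchanged. -/
theorem ConcaveOn.add_le_add_of_le (hσ : ConcaveOn ℝ (Set.Ici 0) σ) {x y h : ℝ} (hx : 0 ≤ x)
    (hxy : x ≤ y) (hh : 0 ≤ h) : σ (y + h) + σ x ≤ σ (x + h) + σ y := by
  rcases hh.eq_or_lt with rfl | hh
  · simp [add_comm]
  have hL : 0 < y + h - x := by linarith
  set θ := h / (y + h - x) with hθ
  have hθ0 : 0 ≤ θ := by positivity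
  have hθ1 : θ ≤ 1 := by rw [hθ, div_le_one hL]; linarith
  have hmul : θ * (y + h - x) = h := div_mul_cancel₀ _ hL.ne'
  have hm1 : x ∈ Set.Ici (0 : ℝ) := hx
  have hm2 : y + h ∈ Set.Ici (0 : ℝ) := by simp only [Set.mem_Ici]; linarith
  have h1 := hσ.2 hm1 hm2 (sub_nonneg.2 hθ1) hθ0 (sub_add_cancel 1 θ)
  have h2 := hσ.2 hm1 hm2 hθ0 (sub_nonneg.2 hθ1) (add_sub_cancel θ 1)
  simp only [smul_eq_mul] at h1 h2
  have e1 : (1 - θ) * x + θ * (y + h) = x + h := by linear_combination hmul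
  have e2 : θ * x + (1 - θ) * (y + h) = y := by linear_combination -hmul
  rw [e1] at h1
  rw [e2] at h2
  linarith

theorem ConcaveOn.map_add_le (hσ : ConcaveOn ℝ (Set.Ici 0) σ) (h0 : σ 0 = 0) {a b : ℝ}
    (ha : 0 ≤ a) (hb : 0 ≤ b) : σ (a + b) ≤ σ a + σ b := by
  have := hσ.add_le_add_of_le le_rfl ha hb
  rw [zero_add, h0] at this
  linarith

/-- The defect σ(a+b) - σ(a) - σ(b) is nonincreasing in a and in b, hence largest at a = b = s. This
is the source of the gain off the diagonal. -/
theorem ConcaveOn.map_add_le_of_le (hσ : ConcaveOn ℝ (Set.Ici 0) σ) {a b s : ℝ}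
    (hs : 0 ≤ s) (ha : s ≤ a) (hb : s ≤ b) : σ (a + b) ≤ σ a + σ b + (σ (2 * s) - 2 * σ s) := by
  have h1 := hσ.add_le_add_of_le (x := 2 * s) (y := a + s) (h := b - s) (by linarith)
    (by linarith) (by linarith)
  have h2 := hσ.add_le_add_of_le (x := s) (y := a) (h := s) hs ha hs
  have h3 := hσ.add_le_add_of_le (x := s) (y := b) (h := s) hs hb hs
  rw [show a + s + (b - s) = a + b by ring, show 2 * s + (b - s) = b + s by ring] at h1
  rw [← two_mul] at h2 h3
  linarith

/-- A single decrease would persist at least linearly and make the function negative. -/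
theorem ConcaveOn.monotoneOn_of_nonneg (hσ : ConcaveOn ℝ (Set.Ici 0) σ)
    (h0 : ∀ t, 0 ≤ t → 0 ≤ σ t) : MonotoneOn σ (Set.Ici 0) := by
  intro a ha b _ hab
  have ha : 0 ≤ a := ha
  by_contra! hlt
  have hstep : ∀ n : ℕ, σ (b + n * (b - a)) ≤ σ a - (n + 1) * (σ a - σ b) := by
    intro n
    induction n with
    | zero => simp
    | succ n ih =>
      have := hσ.add_le_add_of_le (x := a) (y := b + n * (b - a)) (h := b - a) ha
        (by nlinarith [n.cast_nonneg (α := ℝ)]) (by linarith)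
      rw [show b + n * (b - a) + (b - a) = b + (n + 1) * (b - a) by ring,
        show a + (b - a) = b by ring] at this
      push_cast
      linarith
  obtain ⟨n, hn⟩ := exists_nat_gt (σ a / (σ a - σ b))
  rw [div_lt_iff₀ (by linarith)] at hn
  have h1 := hstep n
  have h2 := h0 (b + n * (b - a)) (by nlinarith [n.cast_nonneg (α := ℝ)])
  linarith

/-- The slope σ(t)/t is nonincreasing, written without division. -/
theorem ConcaveOn.mul_le_of_le (hσ : ConcaveOn ℝ (Set.Ici 0) σ) (h0 : σ 0 = 0) {s t : ℝ}
    (hs : 0 ≤ s) (hst : s ≤ t) : s * σ t ≤ t * σ s := by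
  rcases (hs.trans hst).eq_or_lt with h | ht
  · have : s = 0 := by linarith
    subst this; subst h; simp
  have hm1 : (0 : ℝ) ∈ Set.Ici (0 : ℝ) := Set.mem_Ici.2 le_rfl
  have hm2 : t ∈ Set.Ici (0 : ℝ) := ht.le
  have h1 := hσ.2 hm1 hm2 (sub_nonneg.2 ((div_le_one ht).2 hst)) (by positivity)
    (sub_add_cancel 1 (s / t))
  simp only [smul_eq_mul, h0, mul_zero, zero_add] at h1
  rw [div_mul_cancel₀ _ ht.ne', div_mul_eq_mul_div, div_le_iff₀ ht] at h1
  linarith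

theorem concaveOn_log_one_add : ConcaveOn ℝ (Set.Ici 0) fun t : ℝ => Real.log (1 + t) := by
  refine ⟨convex_Ici 0, fun x hx y hy a b ha hb hab => ?_⟩
  have hx : 0 ≤ x := hx
  have hy : 0 ≤ y := hy
  have h := strictConcaveOn_log_Ioi.concaveOn.2 (x := 1 + x) (y := 1 + y)
    (show 0 < 1 + x by linarith) (show 0 < 1 + y by linarith) ha hb hab
  simp only [smul_eq_mul] at h ⊢
  rwa [show a * (1 + x) + b * (1 + y) = 1 + (a * x + b * y) by linear_combination hab] at h

/-- The minimum of `ρ` and `t ↦ δ log (1 + t) + ε t`. -/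
noncomputable def truncatedExponent (ρ : ℝ → ℝ) (δ ε t : ℝ) : ℝ :=
  min (ρ t) (δ * Real.log (1 + t) + ε * t)

theorem concaveOn_truncatedExponent {ρ : ℝ → ℝ} (hρ : ConcaveOn ℝ (Set.Ici 0) ρ) {δ ε : ℝ}
    (hδ : 0 ≤ δ) : ConcaveOn ℝ (Set.Ici 0) (truncatedExponent ρ δ ε) := by
  refine hρ.inf ((concaveOn_log_one_add.smul hδ).add ?_)
  exact ((LinearMap.mulLeft ℝ ε).concaveOn (convex_Ici 0))

end Concave

/-! ### Submultiplicative weights from concave exponents and polynomials -/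

section RadialWeights

variable {d : ℕ} {p : Seminorm ℝ (EuclideanSpace ℝ (Fin d))} {σ : ℝ → ℝ}

theorem isSubmultWeight_exp (hσ : ConcaveOn ℝ (Set.Ici 0) σ) (h0 : σ 0 = 0)
    (hnn : ∀ t, 0 ≤ t → 0 ≤ σ t) : IsSubmultWeight fun x => Real.exp (σ (p x)) where
  map_zero := by simp [h0]
  one_le x := Real.one_le_exp (hnn _ (apply_nonneg p x))
  map_neg x := by rw [map_neg_eq_map]
  map_add_le x y := by
    rw [← Real.exp_add]
    refine Real.exp_le_exp.2 (le_trans ?_ (hσ.map_add_le h0 (apply_nonneg p x) (apply_nonneg p y)))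
    exact hσ.monotoneOn_of_nonneg hnn (Set.mem_Ici.2 (apply_nonneg p _))
      (Set.mem_Ici.2 (add_nonneg (apply_nonneg p x) (apply_nonneg p y))) (map_add_le_add p x y)

theorem IsSubmultWeight.mul {u v : EuclideanSpace ℝ (Fin d) → ℝ} (hu : IsSubmultWeight u)
    (hv : IsSubmultWeight v) : IsSubmultWeight fun x => u x * v x where
  map_zero := by rw [hu.map_zero, hv.map_zero, one_mul]
  one_le x := one_le_mul_of_one_le_of_one_le (hu.one_le x) (hv.one_le x)
  map_neg x := by rw [hu.map_neg, hv.map_neg]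
  map_add_le x y := by
    rw [mul_mul_mul_comm]
    exact mul_le_mul (hu.map_add_le x y) (hv.map_add_le x y)
      (zero_le_one.trans (hv.one_le _))
      (mul_nonneg (zero_le_one.trans (hu.one_le _)) (zero_le_one.trans (hu.one_le _)))

theorem isSubmultWeight_prod (α : Fin d → ℕ) :
    IsSubmultWeight fun x : EuclideanSpace ℝ (Fin d) => ∏ j, (1 + |x j|) ^ α j where
  map_zero := by simp
  one_le x := Finset.prod_induction _ (fun t : ℝ => 1 ≤ t)
    (fun _ _ => one_le_mul_of_one_le_of_one_le) le_rfl
    fun j _ => one_le_pow₀ (by linarith [abs_nonneg (x j)])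
  map_neg x := by simp
  map_add_le x y := by
    rw [← Finset.prod_mul_distrib]
    refine Finset.prod_le_prod (fun j _ => by positivity) fun j _ => ?_
    rw [← mul_pow]
    refine pow_le_pow_left₀ (by positivity) ?_ _
    have := abs_add_le (x j) (y j)
    rw [PiLp.add_apply]
    nlinarith [abs_nonneg (x j), abs_nonneg (y j)]

theorem isSubmultWeight_anisoWeight_exp (α : Fin d → ℕ) (hσ : ConcaveOn ℝ (Set.Ici 0) σ)
    (h0 : σ 0 = 0) (hnn : ∀ t, 0 ≤ t → 0 ≤ σ t) :
    IsSubmultWeight (anisoWeight α fun x => Real.exp (σ (p x))) :=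
  (isSubmultWeight_prod α).mul (isSubmultWeight_exp hσ h0 hnn)

end RadialWeights

/-! ### Comparison of norms and counting points in balls -/

section FiniteDimensional

variable {d : ℕ}

theorem Seminorm.exists_norm_le_mul (p : Seminorm ℝ (EuclideanSpace ℝ (Fin d)))
    (hp : ∀ x, p x = 0 → x = 0) : ∃ c : ℝ, 0 ≤ c ∧ ∀ x, ‖x‖ ≤ c * p x := by
  have hcont : Continuous p := by
    have := (p.convexOn).continuousOn isOpen_univ
    exact continuousOn_univ.1 this
  rcases (Metric.sphere (0 : EuclideanSpace ℝ (Fin d)) 1).eq_empty_or_nonempty with h | h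
  · refine ⟨0, le_rfl, fun x => ?_⟩
    by_contra! hx
    rw [zero_mul] at hx
    have : (‖x‖⁻¹ • x) ∈ Metric.sphere (0 : EuclideanSpace ℝ (Fin d)) 1 := by
      simp [norm_smul, hx.ne']
    rw [h] at this
    exact this
  · obtain ⟨y, hy, hmin⟩ := (isCompact_sphere _ _).exists_isMinOn h hcont.continuousOn
    have hy1 : ‖y‖ = 1 := by simpa using hy
    have hpy : 0 < p y := (apply_nonneg p y).lt_of_ne fun h => by
      rw [hp y h.symm, norm_zero] at hy1; exact zero_ne_one hy1
    refine ⟨(p y)⁻¹, (inv_pos.2 hpy).le, fun x => ?_⟩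
    rcases eq_or_ne x 0 with rfl | hx
    · simp
    have hx0 : 0 < ‖x‖ := norm_pos_iff.2 hx
    have h1 : p y ≤ p (‖x‖⁻¹ • x) := hmin (by simp [norm_smul, hx0.ne'])
    rw [map_smul_eq_mul, norm_inv, norm_norm, inv_mul_eq_div, le_div_iff₀ hx0] at h1
    rwa [inv_mul_eq_div, le_div_iff₀ hpy, mul_comm]

/-- The ball sits in a Euclidean ball of radius c s, which is covered by (2R+1)^d unit cubes based
at k + ℤ^d with R = ⌈c s⌉, each holding at most N points. -/
theorem IsRelativelySeparated.exists_card_le {X : Set (EuclideanSpace ℝ (Fin d))}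
    (hX : IsRelativelySeparated X) (p : Seminorm ℝ (EuclideanSpace ℝ (Fin d)))
    (hp : ∀ x, p x = 0 → x = 0) :
    ∃ K : ℝ, 0 ≤ K ∧ ∀ (s : ℕ) (k : X) (F : Finset X),
      (∀ l ∈ F, p ((k : EuclideanSpace ℝ (Fin d)) - l) ≤ s) → (F.card : ℝ) ≤ K * (1 + s) ^ d := by
  obtain ⟨c, hc, hcp⟩ := p.exists_norm_le_mul hp
  obtain ⟨N, hN⟩ := hX.bounded
  refine ⟨N * (2 * c + 3) ^ d, by positivity, fun s k F hF => ?_⟩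
  set R : ℕ := ⌈c * s⌉₊ with hR
  let f : X → Fin d → ℤ := fun l j =>
    ⌊(l : EuclideanSpace ℝ (Fin d)) j - (k : EuclideanSpace ℝ (Fin d)) j⌋
  have himg : F.image f ⊆ Fintype.piFinset fun _ => Finset.Icc (-(R : ℤ)) R := by
    intro z hz
    obtain ⟨l, hl, rfl⟩ := Finset.mem_image.1 hz
    rw [Fintype.mem_piFinset]
    intro j
    have h1 : |(k : EuclideanSpace ℝ (Fin d)) j - (l : EuclideanSpace ℝ (Fin d)) j| ≤ R := by
      have h2 := PiLp.norm_apply_le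
        ((k : EuclideanSpace ℝ (Fin d)) - (l : EuclideanSpace ℝ (Fin d))) j
      rw [PiLp.sub_apply, Real.norm_eq_abs] at h2
      calc _ ≤ _ := h2
        _ ≤ c * p ((k : EuclideanSpace ℝ (Fin d)) - l) := hcp _
        _ ≤ c * s := by gcongr; exact hF l hl
        _ ≤ R := Nat.le_ceil _
    rw [abs_le] at h1
    rw [Finset.mem_Icc]
    constructor
    · rw [Int.le_floor]; push_cast; linarith
    · have : ((f l j : ℤ) : ℝ) ≤ R := (Int.floor_le _).trans (by linarith)
      exact_mod_cast this
  have hfib : ∀ z ∈ F.image f, (F.filter fun l => f l = z).card ≤ N := by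
    intro z _
    have h1 := hN (WithLp.toLp 2 fun j => (k : EuclideanSpace ℝ (Fin d)) j + z j)
    have h2 : ((F.filter fun l => f l = z).map (Function.Embedding.subtype _) : Set _) ⊆
        X ∩ {y | ∀ j, (WithLp.toLp 2 fun j => (k : EuclideanSpace ℝ (Fin d)) j + z j :
          EuclideanSpace ℝ (Fin d)) j ≤ y j ∧ y j ≤ (WithLp.toLp 2 fun j =>
          (k : EuclideanSpace ℝ (Fin d)) j + z j : EuclideanSpace ℝ (Fin d)) j + 1} := by
      intro y hy
      rw [Finset.mem_coe, Finset.mem_map] at hy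
      obtain ⟨l, hl, rfl⟩ := hy
      refine ⟨l.2, fun j => ?_⟩
      have hz := congrFun (Finset.mem_filter.1 hl).2 j
      have hfl : f l j = z j := hz
      rw [Int.floor_eq_iff] at hfl
      simp only [Function.Embedding.subtype_apply]
      constructor <;> linarith [hfl.1, hfl.2]
    have h3 := (Set.encard_le_encard h2).trans h1
    rw [Set.encard_coe_eq_coe_finsetCard, Finset.card_map] at h3
    exact_mod_cast h3
  have h4 := Finset.card_le_mul_card_image F N hfib
  have h5 := Finset.card_le_card himg
  rw [Fintype.card_piFinset_const, Int.card_Icc] at h5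
  have h6 : ((R : ℤ) + 1 - -(R : ℤ)).toNat = 2 * R + 1 := by omega
  rw [h6] at h5
  have h7 : F.card ≤ N * (2 * R + 1) ^ d :=
    h4.trans (Nat.mul_le_mul_left _ (by simpa using h5))
  have h8 : (R : ℝ) ≤ c * s + 1 := (Nat.ceil_lt_add_one (by positivity)).le
  calc (F.card : ℝ) ≤ N * (2 * R + 1) ^ d := by exact_mod_cast h7
    _ ≤ N * ((2 * c + 3) * (1 + s)) ^ d := by
        gcongr
        nlinarith [s.cast_nonneg (α := ℝ)]
    _ = _ := by rw [mul_pow]; ring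

end FiniteDimensional

/-! ### From admissible weights to growth exponents -/

section Admissible

variable {d : ℕ} {ν : EuclideanSpace ℝ (Fin d) → ℝ}

/-- A nonnegative concave function vanishing at `0`, of sublinear growth, which dominates
`t ↦ δ log (1 + t)`. -/
structure IsGrowthExponent (ρ : ℝ → ℝ) (δ : ℝ) : Prop where
  concaveOn : ConcaveOn ℝ (Set.Ici 0) ρ
  nonneg : ∀ t, 0 ≤ t → 0 ≤ ρ t
  map_zero : ρ 0 = 0
  log_le : ∀ t, 0 ≤ t → δ * Real.log (1 + t) ≤ ρ t
  sublinear : ∀ ε > 0, ∃ T, 0 ≤ T ∧ ∀ t, T ≤ t → ρ t ≤ ε * t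

theorem isGrowthExponent_log : IsGrowthExponent (fun t => Real.log (1 + t)) 1 where
  concaveOn := concaveOn_log_one_add
  nonneg t ht := Real.log_nonneg (by linarith)
  map_zero := by simp
  log_le t _ := by rw [one_mul]
  sublinear ε hε := by
    have h := Real.isLittleO_log_id_atTop.bound (half_pos hε)
    obtain ⟨T, hT⟩ := Filter.eventually_atTop.1 h
    refine ⟨max T 1, le_max_of_le_right zero_le_one, fun t ht => ?_⟩
    have ht1 : 1 ≤ t := (le_max_right _ _).trans ht
    have h1 := hT (1 + t) (by linarith [(le_max_left T 1).trans ht])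
    rw [id, Real.norm_eq_abs, Real.norm_eq_abs, abs_of_pos (by linarith : 0 < 1 + t)] at h1
    refine (le_abs_self _).trans (h1.trans ?_)
    nlinarith

/-- The constant c is absorbed by shrinking δ: for large t half of the logarithm pays for it, and
for small t concavity bounds ρ below by a chord, which dominates a multiple of log(1+t). -/
theorem exists_log_le_of_concaveOn {ρ : ℝ → ℝ} (hρ : ConcaveOn ℝ (Set.Ici 0) ρ)
    (h0 : ρ 0 = 0) {δ c : ℝ} (hδ : 0 < δ) (hδ1 : δ ≤ 1) (hc : 0 ≤ c)
    (h : ∀ t, 0 ≤ t → δ * Real.log (1 + t) - c ≤ ρ t) :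
    ∃ δ', 0 < δ' ∧ δ' ≤ 1 ∧ ∀ t, 0 ≤ t → δ' * Real.log (1 + t) ≤ ρ t := by
  -- Chosen so that (δ/2) log(1+t) ≥ c for t ≥ t₁, and so that ρ(t₁) ≥ c + 1 is positive.
  set t₁ : ℝ := Real.exp ((2 * c + 1) / δ) - 1 with ht₁
  have hpos : 0 < t₁ := by
    have : 1 < Real.exp ((2 * c + 1) / δ) := Real.one_lt_exp_iff.2 (by positivity)
    linarith
  have hlog : δ * Real.log (1 + t₁) = 2 * c + 1 := by
    rw [ht₁, add_sub_cancel, Real.log_exp, mul_div_cancel₀ _ hδ.ne']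
  have hρ₁ : 0 < ρ t₁ := by
    have := h t₁ hpos.le
    linarith
  refine ⟨min (δ / 2) (ρ t₁ / t₁), lt_min (half_pos hδ) (div_pos hρ₁ hpos),
    (min_le_left _ _).trans (by linarith), fun t ht => ?_⟩
  have hl0 : 0 ≤ Real.log (1 + t) := Real.log_nonneg (by linarith)
  rcases le_total t₁ t with htt | htt
  · have h1 : Real.log (1 + t₁) ≤ Real.log (1 + t) :=
      Real.log_le_log (by linarith) (by linarith)
    have h2 := h t ht
    have h3 : min (δ / 2) (ρ t₁ / t₁) * Real.log (1 + t) ≤ δ / 2 * Real.log (1 + t) :=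
      mul_le_mul_of_nonneg_right (min_le_left _ _) hl0
    nlinarith
  · have h1 : Real.log (1 + t) ≤ t := by
      have := Real.log_le_sub_one_of_pos (show 0 < 1 + t by linarith)
      linarith
    have h2 : t * ρ t₁ ≤ t₁ * ρ t := hρ.mul_le_of_le h0 ht htt
    calc _ ≤ ρ t₁ / t₁ * Real.log (1 + t) := mul_le_mul_of_nonneg_right (min_le_right _ _) hl0
      _ ≤ ρ t₁ / t₁ * t := by gcongr
      _ ≤ ρ t := by rw [div_mul_eq_mul_div, div_le_iff₀ hpos]; linarith

/-- As the slope is nonincreasing, one integer n with ρ(n)/n < ε suffices. -/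
theorem sublinear_of_tendsto {ρ : ℝ → ℝ} (hρ : ConcaveOn ℝ (Set.Ici 0) ρ) (h0 : ρ 0 = 0)
    (h : Filter.Tendsto (fun n : ℕ => ρ n / n) Filter.atTop (𝓝 0)) {ε : ℝ} (hε : 0 < ε) :
    ∃ T, 0 ≤ T ∧ ∀ t, T ≤ t → ρ t ≤ ε * t := by
  obtain ⟨n, hn, hn1⟩ := ((h.eventually (gt_mem_nhds hε)).and
    (Filter.eventually_ge_atTop 1)).exists
  have hn0 : (0 : ℝ) < n := by exact_mod_cast hn1
  refine ⟨n, hn0.le, fun t ht => ?_⟩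
  have h1 := hρ.mul_le_of_le h0 hn0.le ht
  rw [div_lt_iff₀ hn0] at hn
  have h2 : t * ρ n ≤ t * (ε * n) := mul_le_mul_of_nonneg_left hn.le (hn0.le.trans ht)
  refine le_of_mul_le_mul_left (a := (n : ℝ)) ?_ hn0
  linarith

theorem IsAdmissibleWeight.exists_growthExponent (hν : IsAdmissibleWeight ν) {C δ : ℝ}
    (hC : 0 < C) (hδ : 0 < δ) (hδ1 : δ ≤ 1) (hgrowth : ∀ x, C * (1 + ‖x‖) ^ δ ≤ ν x) :
    ∃ (p : Seminorm ℝ (EuclideanSpace ℝ (Fin d))) (ρ : ℝ → ℝ) (δ' : ℝ),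
      (∀ x, p x = 0 → x = 0) ∧ 0 < δ' ∧ δ' ≤ 1 ∧ IsGrowthExponent ρ δ' ∧
        ν = fun x => Real.exp (ρ (p x)) := by
  obtain ⟨p, ρ, hp, -, hρ, hnn, h0, hform⟩ := hν.exists_form
  rcases subsingleton_or_nontrivial (EuclideanSpace ℝ (Fin d)) with hE | hE
  -- In dimension 0 the weight sees only ρ(0), so ρ may be exchanged for log(1+t).
  · refine ⟨p, _, 1, hp, one_pos, le_rfl, isGrowthExponent_log, funext fun x => ?_⟩
    rw [hform, Subsingleton.elim x 0, map_zero, h0]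
    simp
  obtain ⟨e, he⟩ := exists_ne (0 : EuclideanSpace ℝ (Fin d))
  have hpe : 0 < p e := (apply_nonneg p e).lt_of_ne fun h => he (hp e h.symm)
  set z := (p e)⁻¹ • e with hz
  have hpz : ∀ t : ℝ, 0 ≤ t → p (t • z) = t := by
    intro t ht
    rw [hz, map_smul_eq_mul, map_smul_eq_mul, norm_inv, Real.norm_of_nonneg hpe.le,
      inv_mul_cancel₀ hpe.ne', mul_one, Real.norm_of_nonneg ht]
  have hz0 : 0 < ‖z‖ := by
    rw [norm_pos_iff]; exact smul_ne_zero (inv_ne_zero hpe.ne') he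
  have hρν : ∀ t, 0 ≤ t → ρ t = Real.log (ν (t • z)) := fun t ht => by
    rw [hform, hpz t ht, Real.log_exp]
  have hm : 0 < min 1 ‖z‖ := lt_min one_pos hz0
  have hm0 : Real.log (min 1 ‖z‖) ≤ 0 := Real.log_nonpos hm.le (min_le_left _ _)
  have hlow : ∀ t, 0 ≤ t →
      δ * Real.log (1 + t) - (|Real.log C| - δ * Real.log (min 1 ‖z‖)) ≤ ρ t := by
    intro t ht
    have h1 : C * (min 1 ‖z‖ * (1 + t)) ^ δ ≤ ν (t • z) := by
      refine le_trans ?_ (hgrowth _)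
      have : min 1 ‖z‖ * (1 + t) ≤ 1 + ‖t • z‖ := by
        rw [norm_smul t z, Real.norm_of_nonneg ht]
        nlinarith [min_le_left 1 ‖z‖, min_le_right 1 ‖z‖]
      gcongr
    have h2 := Real.log_le_log (by positivity) h1
    rw [← hρν t ht, Real.log_mul hC.ne' (by positivity), Real.log_rpow (by positivity),
      Real.log_mul hm.ne' (by positivity)] at h2
    have := neg_abs_le (Real.log C)
    linarith
  obtain ⟨δ', hδ', hδ'1, hlog⟩ := exists_log_le_of_concaveOn hρ h0 hδ hδ1
    (by nlinarith [abs_nonneg (Real.log C)]) hlow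
  have hgrs : Filter.Tendsto (fun n : ℕ => ρ n / n) Filter.atTop (𝓝 0) := by
    have h1 := (Real.continuousAt_log one_ne_zero).tendsto.comp (hν.grs z)
    rw [Real.log_one] at h1
    refine h1.congr fun n => ?_
    rw [Function.comp_apply, Real.log_rpow (hν.pos _), ← hρν n n.cast_nonneg, one_div,
      inv_mul_eq_div]
  exact ⟨p, ρ, δ', hp, hδ', hδ'1, ⟨hρ, hnn, h0, hlog,
    fun ε hε => sublinear_of_tendsto hρ h0 hgrs hε⟩, funext hform⟩

end Admissible

/-! ### Construction of the truncated weights -/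

section Truncation

variable {ρ : ℝ → ℝ} {δ : ℝ}

theorem truncatedExponent_zero (h0 : ρ 0 = 0) (δ ε : ℝ) : truncatedExponent ρ δ ε 0 = 0 := by
  simp [truncatedExponent, h0]

theorem truncatedExponent_nonneg (hnn : ∀ t, 0 ≤ t → 0 ≤ ρ t) {ε t : ℝ} (hδ : 0 ≤ δ)
    (hε : 0 ≤ ε) (ht : 0 ≤ t) : 0 ≤ truncatedExponent ρ δ ε t :=
  le_min (hnn t ht) (add_nonneg (mul_nonneg hδ (Real.log_nonneg (by linarith)))
    (mul_nonneg hε ht))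

/-- The hypothesis says that the logarithmic branch is active at s. In the difference the linear
terms cancel, and log(1+2s) ≤ log 2 + log(1+s). -/
theorem truncatedExponent_gain {ε s : ℝ} (hs : 0 ≤ s) (hδ : 0 ≤ δ)
    (h : δ * Real.log (1 + s) + ε * s ≤ ρ s) :
    truncatedExponent ρ δ ε (2 * s) - 2 * truncatedExponent ρ δ ε s ≤
      δ * Real.log (2 / (1 + s)) := by
  have h1 : truncatedExponent ρ δ ε (2 * s) ≤ δ * Real.log (1 + 2 * s) + ε * (2 * s) :=
    min_le_right _ _
  have h2 : truncatedExponent ρ δ ε s = δ * Real.log (1 + s) + ε * s := min_eq_right h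
  have h3 : Real.log (1 + 2 * s) ≤ Real.log 2 + Real.log (1 + s) := by
    rw [← Real.log_mul two_ne_zero (by positivity)]
    exact Real.log_le_log (by positivity) (by linarith)
  rw [Real.log_div two_ne_zero (by positivity)]
  have h4 := mul_le_mul_of_nonneg_left h3 hδ
  rw [h2]
  linarith

theorem exists_isWeightTruncation {d : ℕ} {X : Set (EuclideanSpace ℝ (Fin d))}
    (hX : IsRelativelySeparated X) (α : Fin d → ℕ) {p : Seminorm ℝ (EuclideanSpace ℝ (Fin d))}
    (hp : ∀ x, p x = 0 → x = 0) (hδ : 0 < δ) (hδ1 : δ ≤ 1) (hρ : IsGrowthExponent ρ δ) :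
    ∃ (u : ℕ → EuclideanSpace ℝ (Fin d) → ℝ) (K δ' : ℝ) (D : ℕ),
      IsWeightTruncation X (anisoWeight α fun x => Real.exp (ρ (p x))) p u K δ' D := by
  obtain ⟨c, hc, hcp⟩ := p.exists_norm_le_mul hp
  obtain ⟨K, hK, hcard⟩ := hX.exists_card_le p hp
  set P : EuclideanSpace ℝ (Fin d) → ℝ := fun x => ∏ j, (1 + |x j|) ^ α j with hP
  have hPw : IsSubmultWeight P := isSubmultWeight_prod α
  have hP0 : ∀ x, 0 ≤ P x := fun x => zero_le_one.trans (hPw.one_le x)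
  set ε : ℕ → ℝ := fun j => 1 / ((j : ℝ) + 1) with hε
  have hε0 : ∀ j, 0 < ε j := fun j => by positivity
  have hεlim : Filter.Tendsto ε Filter.atTop (𝓝 0) := tendsto_one_div_add_atTop_nhds_zero_nat
  have hεs : ∀ (s : ℕ) (r : ℝ), 0 < r → ∀ᶠ j in Filter.atTop, ε j * s < r := fun s r hr => by
    have h := hεlim.mul_const (s : ℝ)
    rw [zero_mul] at h
    exact h.eventually (gt_mem_nhds hr)
  -- Half of δ leaves room: since ρ(s) ≥ δ log(1+s), the extra term ε_j s fits under ρ(s) once j is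
  -- large.
  set σ : ℕ → ℝ → ℝ := fun j => truncatedExponent ρ (δ / 2) (ε j) with hσ
  have hδ2 : 0 ≤ δ / 2 := by linarith
  have hσc : ∀ j, ConcaveOn ℝ (Set.Ici 0) (σ j) := fun j =>
    concaveOn_truncatedExponent hρ.concaveOn hδ2
  have hσ0 : ∀ j, σ j 0 = 0 := fun j => truncatedExponent_zero hρ.map_zero _ _
  have hσnn : ∀ j t, 0 ≤ t → 0 ≤ σ j t := fun j t ht =>
    truncatedExponent_nonneg hρ.nonneg hδ2 (hε0 j).le ht
  have hσmono : ∀ j, MonotoneOn (σ j) (Set.Ici 0) := fun j =>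
    (hσc j).monotoneOn_of_nonneg (hσnn j)
  have hp0 : ∀ x, 0 ≤ p x := fun x => apply_nonneg p x
  set u : ℕ → EuclideanSpace ℝ (Fin d) → ℝ := fun j x => P x * Real.exp (σ j (p x)) with hu
  set m : ℕ := ∑ j, α j with hm
  -- The degree d comes from counting points, m from the anisotropic product, and 1 from
  -- exponentiating the logarithm.
  refine ⟨u, max K ((1 + c) ^ m * Real.exp 1), δ / 2, d + (m + 1), ?_⟩
  refine ⟨le_max_of_le_left hK, half_pos hδ, fun j => ?_, fun j x => ?_, fun j x => ?_,
    fun j => ?_, fun s => ?_, fun s => ?_, fun s k F hF => ?_⟩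
  · exact isSubmultWeight_anisoWeight_exp α (hσc j) (hσ0 j) (hσnn j)
  · refine mul_le_mul_of_nonneg_left (Real.exp_le_exp.2 ?_) (hP0 x)
    refine min_le_min le_rfl (add_le_add le_rfl (mul_le_mul_of_nonneg_right ?_ (hp0 x)))
    simp only [hε]
    push_cast
    exact one_div_le_one_div_of_le (by positivity) (by linarith)
  · exact mul_le_mul_of_nonneg_left (Real.exp_le_exp.2 (min_le_left _ _)) (hP0 x)
  -- Beyond T the truncation is inactive by sublinearity; below T the exponent is at most ρ(T).
  · obtain ⟨T, hT0, hT⟩ := hρ.sublinear (ε j) (hε0 j)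
    refine ⟨Real.exp (ρ T), fun x => ?_⟩
    have hle : ρ (p x) ≤ ρ T + σ j (p x) := by
      rcases le_total T (p x) with h | h
      · have h1 : σ j (p x) = ρ (p x) := min_eq_left ((hT _ h).trans
          (le_add_of_nonneg_left (mul_nonneg hδ2 (Real.log_nonneg (by linarith [hp0 x])))))
        rw [h1]
        exact le_add_of_nonneg_left (hρ.nonneg T hT0)
      · exact (hρ.concaveOn.monotoneOn_of_nonneg hρ.nonneg (Set.mem_Ici.2 (hp0 x))
          (Set.mem_Ici.2 hT0) h).trans (le_add_of_nonneg_right (hσnn j _ (hp0 x)))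
    calc P x * Real.exp (ρ (p x)) ≤ P x * Real.exp (ρ T + σ j (p x)) :=
          mul_le_mul_of_nonneg_left (Real.exp_le_exp.2 hle) (hP0 x)
      _ = Real.exp (ρ T) * u j x := by rw [Real.exp_add]; simp only [hu]; ring
  · filter_upwards [hεs s 1 one_pos] with j hj x hx
    have hs0 : (0 : ℝ) ≤ s := s.cast_nonneg
    have h1 : P x ≤ ((1 + c) * (1 + s)) ^ m := by
      rw [hm, ← Finset.prod_pow_eq_pow_sum]
      refine Finset.prod_le_prod (fun j _ => by positivity) fun j _ => ?_
      refine pow_le_pow_left₀ (by positivity) ?_ _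
      have h2 : |x j| ≤ c * s := by
        have := (PiLp.norm_apply_le x j).trans ((hcp x).trans (mul_le_mul_of_nonneg_left hx hc))
        rwa [Real.norm_eq_abs] at this
      nlinarith
    have h2 : σ j (p x) ≤ Real.log (1 + s) + 1 := by
      refine (hσmono j (Set.mem_Ici.2 (hp0 x)) (Set.mem_Ici.2 hs0) hx).trans ?_
      refine (min_le_right _ _).trans (add_le_add ?_ hj.le)
      exact mul_le_of_le_one_left (Real.log_nonneg (by linarith)) (by linarith)
    have h3 : Real.exp (σ j (p x)) ≤ (1 + s) * Real.exp 1 := by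
      refine (Real.exp_le_exp.2 h2).trans_eq ?_
      rw [Real.exp_add, Real.exp_log (by positivity)]
    calc u j x ≤ ((1 + c) * (1 + s)) ^ m * ((1 + s) * Real.exp 1) :=
          mul_le_mul h1 h3 (Real.exp_pos _).le (by positivity)
      _ = (1 + c) ^ m * Real.exp 1 * (1 + s) ^ (m + 1) := by rw [mul_pow]; ring
      _ ≤ _ := by
          refine mul_le_mul (le_max_right _ _) ?_ (by positivity) (le_max_of_le_left hK)
          exact pow_le_pow_right₀ (by linarith) (by omega)
  · have hev : ∀ᶠ j in Filter.atTop, δ / 2 * Real.log (1 + s) + ε j * s ≤ ρ s := by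
      rcases Nat.eq_zero_or_pos s with rfl | hs
      · exact Filter.Eventually.of_forall fun j => by simp [hρ.map_zero]
      · have hs' : (0 : ℝ) < s := by exact_mod_cast hs
        have hlog : 0 < Real.log (1 + s) := Real.log_pos (by linarith)
        filter_upwards [hεs s (δ / 2 * Real.log (1 + s)) (by positivity)] with j hj
        have := hρ.log_le s hs'.le
        linarith
    filter_upwards [hev] with j hj x y hx hy
    have hs0 : (0 : ℝ) ≤ s := s.cast_nonneg
    have h1 : σ j (p (x + y)) ≤
        σ j (p x) + σ j (p y) + δ / 2 * Real.log (2 / (1 + s)) := by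
      calc σ j (p (x + y)) ≤ σ j (p x + p y) := hσmono j (Set.mem_Ici.2 (hp0 _))
            (Set.mem_Ici.2 (add_nonneg (hp0 x) (hp0 y))) (map_add_le_add p x y)
        _ ≤ _ := (hσc j).map_add_le_of_le hs0 hx hy
        _ ≤ _ := add_le_add le_rfl (truncatedExponent_gain hs0 hδ2 hj)
    have h2 : Real.exp (δ / 2 * Real.log (2 / (1 + s))) = (2 / (1 + s) : ℝ) ^ (δ / 2) := by
      rw [Real.rpow_def_of_pos (by positivity), mul_comm]
    calc u j (x + y) ≤ (P x * P y) *
          Real.exp (σ j (p x) + σ j (p y) + δ / 2 * Real.log (2 / (1 + s))) :=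
          mul_le_mul (hPw.map_add_le x y) (Real.exp_le_exp.2 h1) (Real.exp_pos _).le
            (mul_nonneg (hP0 x) (hP0 y))
      _ = _ := by rw [Real.exp_add, Real.exp_add, h2]; simp only [hu]; ring
  · refine (hcard s k F hF).trans ?_
    have hs0 : (0 : ℝ) ≤ s := s.cast_nonneg
    exact mul_le_mul (le_max_left _ _) (pow_le_pow_right₀ (by linarith) (by omega))
      (by positivity) (le_max_of_le_left hK)

end Truncation

/-! ### The graph norm of the derivations -/

section GraphNorm

variable {d : ℕ} {X : Set (EuclideanSpace ℝ (Fin d))} {H : Type*}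
  [NormedAddCommGroup H] [InnerProductSpace ℂ H] {ν : EuclideanSpace ℝ (Fin d) → ℝ}

/-- Binomial expansion in each coordinate, with every coefficient bounded by 2^(α j). -/
theorem prod_one_add_pow_le (α : Fin d → ℕ) (t : Fin d → ℝ) (ht : ∀ j, 0 ≤ t j) :
    ∏ j, (1 + t j) ^ α j ≤ 2 ^ (∑ j, α j) * ∑ β ∈ Finset.Iic α, ∏ j, t j ^ β j := by
  have h1 : ∑ β ∈ Finset.Iic α, ∏ j, t j ^ β j = ∏ j, ∑ b ∈ Finset.Iic (α j), t j ^ b :=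
    (Finset.prod_univ_sum (fun j => Finset.Iic (α j)) fun j b => t j ^ b).symm
  rw [h1, ← Finset.prod_pow_eq_pow_sum, ← Finset.prod_mul_distrib]
  refine Finset.prod_le_prod (fun j _ => pow_nonneg (by linarith [ht j]) _) fun j _ => ?_
  have h2 : Finset.Iic (α j) = Finset.range (α j + 1) := by ext; simp
  rw [add_comm, add_pow, h2, Finset.mul_sum]
  refine Finset.sum_le_sum fun b _ => ?_
  rw [one_pow, mul_one, mul_comm]
  refine mul_le_mul_of_nonneg_right ?_ (pow_nonneg (ht j) _)
  exact_mod_cast Nat.choose_le_two_pow (α j) b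

theorem prod_pow_le_of_le {α β : Fin d → ℕ} (hβ : β ≤ α) (t : Fin d → ℝ) (ht : ∀ j, 0 ≤ t j) :
    ∏ j, t j ^ β j ≤ ∏ j, (1 + t j) ^ α j := by
  refine Finset.prod_le_prod (fun j _ => pow_nonneg (ht j) _) fun j _ => ?_
  exact (pow_le_pow_left₀ (ht j) (by linarith) _).trans
    (pow_le_pow_right₀ (by linarith [ht j]) (hβ j))

theorem norm_deltaPow (β : Fin d → ℕ) (A : OpMatrix X H) (k l : X) :
    ‖deltaPow β A k l‖ = (∏ j, |((k : EuclideanSpace ℝ (Fin d)) - l) j| ^ β j) * ‖A k l‖ := by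
  rw [deltaPow, norm_smul, Complex.norm_real, Real.norm_eq_abs, Finset.abs_prod]
  simp only [abs_pow, PiLp.sub_apply]

theorem schurENorm_deltaPow (β : Fin d → ℕ) (A : OpMatrix X H) :
    schurENorm ν (deltaPow β A) = schurENorm (fun x => (∏ j, |x j| ^ β j) * ν x) A := by
  have h : ∀ k l : X, ‖deltaPow β A k l‖ * ν ((k : EuclideanSpace ℝ (Fin d)) - l) =
      ‖A k l‖ * ((∏ j, |((k : EuclideanSpace ℝ (Fin d)) - l) j| ^ β j) *
        ν ((k : EuclideanSpace ℝ (Fin d)) - l)) := fun k l => by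
    rw [norm_deltaPow]; ring
  simp only [schurENorm, h]

theorem graphENorm_le (hν : ∀ x, 0 ≤ ν x) (α : Fin d → ℕ) (A : OpMatrix X H) :
    graphENorm α ν A ≤ (Finset.Iic α).card * schurENorm (anisoWeight α ν) A := by
  rw [graphENorm, ← nsmul_eq_mul]
  refine Finset.sum_le_card_nsmul _ _ _ fun β hβ => ?_
  rw [schurENorm_deltaPow]
  refine schurENorm_mono_weight (fun x => ?_) A
  exact mul_le_mul_of_nonneg_right
    (prod_pow_le_of_le (Finset.mem_Iic.1 hβ) _ fun j => abs_nonneg _) (hν x)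

theorem schurENorm_anisoWeight_le (hν : ∀ x, 0 ≤ ν x) (α : Fin d → ℕ) (A : OpMatrix X H) :
    schurENorm (anisoWeight α ν) A ≤ 2 ^ (∑ j, α j) * graphENorm α ν A := by
  simp only [graphENorm, schurENorm_deltaPow]
  simp only [schurENorm_eq_kernelSchur]
  refine le_trans ?_ (mul_le_mul_right (kernelSchur_sum_le _ _) _)
  refine le_trans (kernelSchur_mono fun k l => ?_) (kernelSchur_const_mul_le _ _)
  rw [← Finset.mul_sum, mul_left_comm]
  refine mul_le_mul_right ?_ _
  rw [← ENNReal.ofReal_sum_of_nonneg fun β _ =>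
    mul_nonneg (Finset.prod_nonneg fun j _ => pow_nonneg (abs_nonneg _) _) (hν _)]
  have h2 : (2 : ℝ≥0∞) ^ (∑ j, α j) = ENNReal.ofReal (2 ^ (∑ j, α j)) := by
    rw [ENNReal.ofReal_pow zero_le_two, ENNReal.ofReal_ofNat]
  rw [h2, ← ENNReal.ofReal_mul (by positivity)]
  refine ENNReal.ofReal_le_ofReal ?_
  rw [← Finset.sum_mul, ← mul_assoc]
  exact mul_le_mul_of_nonneg_right (prod_one_add_pow_le α _ fun j => abs_nonneg _) (hν _)

theorem deltaPow_add (β : Fin d → ℕ) (A B : OpMatrix X H) :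
    deltaPow β (A + B) = deltaPow β A + deltaPow β B := by
  funext k l; exact smul_add _ _ _

theorem deltaPow_smul (β : Fin d → ℕ) (c : ℂ) (A : OpMatrix X H) :
    deltaPow β (c • A) = c • deltaPow β A := by
  funext k l; exact smul_comm (_ : ℂ) c (A k l)

theorem graphENorm_add_le (α : Fin d → ℕ) (A B : OpMatrix X H) :
    graphENorm α ν (A + B) ≤ graphENorm α ν A + graphENorm α ν B := by
  simp only [graphENorm, deltaPow_add, ← Finset.sum_add_distrib]
  exact Finset.sum_le_sum fun β _ => schurENorm_add_le _ _

theorem graphENorm_smul (α : Fin d → ℕ) (c : ℂ) (A : OpMatrix X H) :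
    graphENorm α ν (c • A) = ‖c‖ₑ * graphENorm α ν A := by
  simp only [graphENorm, deltaPow_smul, schurENorm_smul, Finset.mul_sum]

end GraphNorm

/-! ### The norm of left multiplication -/

namespace AnisoSchur

variable {d : ℕ} {X : Set (EuclideanSpace ℝ (Fin d))} {H : Type*}
  [NormedAddCommGroup H] [InnerProductSpace ℂ H] [CompleteSpace H]
  {ν : EuclideanSpace ℝ (Fin d) → ℝ} {α : Fin d → ℕ}
  [hw : Fact (IsSubmultWeight (anisoWeight α ν))]

/-- The operator norm, with respect to the graph norm, of left multiplication by `A`. -/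
noncomputable def leftMulENorm (A : AnisoSchur X H ν α) : ℝ≥0∞ :=
  ⨆ (B : AnisoSchur X H ν α) (_ : graphENorm α ν B.entry = 1), graphENorm α ν (A * B).entry

theorem graphENorm_ne_top (hν : ∀ x, 0 ≤ ν x) (A : AnisoSchur X H ν α) :
    graphENorm α ν A.entry ≠ ∞ :=
  ne_top_of_le_ne_top (ENNReal.mul_ne_top (ENNReal.natCast_ne_top _) A.finite.ne)
    (graphENorm_le hν α A.entry)

theorem eq_zero_of_graphENorm (hν : ∀ x, 0 ≤ ν x) {A : AnisoSchur X H ν α}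
    (h : graphENorm α ν A.entry = 0) : A = 0 := by
  have h1 := schurENorm_anisoWeight_le hν α A.entry
  rw [h, mul_zero, nonpos_iff_eq_zero] at h1
  exact AnisoSchur.ext (eq_zero_of_schurENorm_eq_zero hw.out h1)

theorem graphENorm_zero : graphENorm α ν (0 : AnisoSchur X H ν α).entry = 0 := by
  have := graphENorm_smul (ν := ν) α 0 (0 : OpMatrix X H)
  rw [zero_smul, enorm_zero, zero_mul] at this
  exact this

theorem graphENorm_mul_le (hν : ∀ x, 0 ≤ ν x) (A B : AnisoSchur X H ν α) :
    graphENorm α ν (A * B).entry ≤ A.leftMulENorm * graphENorm α ν B.entry := by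
  rcases eq_or_ne (graphENorm α ν B.entry) 0 with h | h
  · rw [eq_zero_of_graphENorm hν h, mul_zero, graphENorm_zero]
    exact zero_le
  have hfin := graphENorm_ne_top hν B
  set r : ℝ := (graphENorm α ν B.entry).toReal with hr
  have hr0 : 0 < r := ENNReal.toReal_pos h hfin
  have hrc : (r : ℂ) ≠ 0 := by exact_mod_cast hr0.ne'
  have hre : ‖(r : ℂ)‖ₑ = graphENorm α ν B.entry := by
    rw [← ofReal_norm, Complex.norm_real, Real.norm_of_nonneg hr0.le, hr, ENNReal.ofReal_toReal hfin]
  have h1 : graphENorm α ν ((r : ℂ)⁻¹ • B).entry = 1 := by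
    rw [smul_entry, graphENorm_smul, enorm_inv hrc, hre, ENNReal.inv_mul_cancel h hfin]
  have h2 : graphENorm α ν (A * (r : ℂ)⁻¹ • B).entry ≤ A.leftMulENorm :=
    le_iSup₂ (f := fun (B : AnisoSchur X H ν α) (_ : graphENorm α ν B.entry = 1) =>
      graphENorm α ν (A * B).entry) _ h1
  have h3 : A * B = (r : ℂ) • (A * (r : ℂ)⁻¹ • B) := by
    rw [mul_smul_comm, smul_inv_smul₀ hrc]
  rw [h3, smul_entry, graphENorm_smul, hre, mul_comm]
  exact mul_le_mul_left h2 _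

theorem leftMulENorm_le_of_forall {A : AnisoSchur X H ν α} {M : ℝ≥0∞}
    (h : ∀ B : AnisoSchur X H ν α, graphENorm α ν (A * B).entry ≤ M * graphENorm α ν B.entry) :
    A.leftMulENorm ≤ M :=
  iSup₂_le fun B hB => (h B).trans_eq (by rw [hB, mul_one])

theorem leftMulENorm_le (hν : ∀ x, 0 ≤ ν x) (A : AnisoSchur X H ν α) :
    A.leftMulENorm ≤ (Finset.Iic α).card * 2 ^ (∑ j, α j) *
      schurENorm (anisoWeight α ν) A.entry := by
  refine leftMulENorm_le_of_forall fun B => ?_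
  calc graphENorm α ν (A * B).entry
      ≤ (Finset.Iic α).card * schurENorm (anisoWeight α ν) (A * B).entry := graphENorm_le hν _ _
    _ ≤ (Finset.Iic α).card * (schurENorm (anisoWeight α ν) A.entry *
          schurENorm (anisoWeight α ν) B.entry) :=
        mul_le_mul_right (schurENorm_matrixMul_le hw.out _ _) _
    _ ≤ (Finset.Iic α).card * (schurENorm (anisoWeight α ν) A.entry *
          (2 ^ (∑ j, α j) * graphENorm α ν B.entry)) :=
        mul_le_mul_right (mul_le_mul_right (schurENorm_anisoWeight_le hν _ _) _) _
    _ = _ := by ring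

theorem leftMulENorm_ne_top (hν : ∀ x, 0 ≤ ν x) (A : AnisoSchur X H ν α) :
    A.leftMulENorm ≠ ∞ :=
  ne_top_of_le_ne_top (ENNReal.mul_ne_top (by finiteness) A.finite.ne) (leftMulENorm_le hν A)

theorem schurENorm_one_entry_le :
    schurENorm (anisoWeight α ν) (1 : AnisoSchur X H ν α).entry ≤ 1 := by
  classical
  convert schurENorm_one_le (X := X) (H := H) hw.out using 1
  congr 1

/-- Left multiplication is tested on the unit, whose graph norm is at most the number of β ≤ α. -/
theorem schurENorm_le_leftMulENorm (hν : ∀ x, 0 ≤ ν x) (A : AnisoSchur X H ν α) :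
    schurENorm (anisoWeight α ν) A.entry ≤
      (Finset.Iic α).card * 2 ^ (∑ j, α j) * A.leftMulENorm := by
  calc schurENorm (anisoWeight α ν) A.entry
      ≤ 2 ^ (∑ j, α j) * graphENorm α ν (A * 1).entry := by
        rw [mul_one]; exact schurENorm_anisoWeight_le hν _ _
    _ ≤ 2 ^ (∑ j, α j) * (A.leftMulENorm *
          graphENorm α ν (1 : AnisoSchur X H ν α).entry) :=
        mul_le_mul_right (graphENorm_mul_le hν A 1) _
    _ ≤ 2 ^ (∑ j, α j) * (A.leftMulENorm * ((Finset.Iic α).card * 1)) := by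
        refine mul_le_mul_right (mul_le_mul_right ((graphENorm_le hν _ _).trans ?_) _) _
        exact mul_le_mul_right schurENorm_one_entry_le _
    _ = _ := by ring

theorem leftMulENorm_add_le (hν : ∀ x, 0 ≤ ν x) (A B : AnisoSchur X H ν α) :
    (A + B).leftMulENorm ≤ A.leftMulENorm + B.leftMulENorm := by
  refine leftMulENorm_le_of_forall fun C => ?_
  rw [add_mul, add_mul, add_entry]
  exact (graphENorm_add_le _ _ _).trans
    (add_le_add (graphENorm_mul_le hν A C) (graphENorm_mul_le hν B C))

theorem leftMulENorm_mul_le (hν : ∀ x, 0 ≤ ν x) (A B : AnisoSchur X H ν α) :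
    (A * B).leftMulENorm ≤ A.leftMulENorm * B.leftMulENorm := by
  refine leftMulENorm_le_of_forall fun C => ?_
  rw [mul_assoc, mul_assoc]
  exact (graphENorm_mul_le hν A _).trans (mul_le_mul_right (graphENorm_mul_le hν B C) _)

theorem leftMulENorm_smul (c : ℂ) (A : AnisoSchur X H ν α) :
    (c • A).leftMulENorm = ‖c‖ₑ * A.leftMulENorm := by
  simp only [leftMulENorm, smul_mul_assoc, smul_entry, graphENorm_smul, ENNReal.mul_iSup]

/-- The norm of `A` as a left multiplication operator for the graph norm. -/
noncomputable def leftMulAlgebraNorm (hν : ∀ x, 0 ≤ ν x) : AlgebraNorm ℂ (AnisoSchur X H ν α) where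
  toFun A := A.leftMulENorm.toReal
  map_zero' := by
    have := leftMulENorm_smul (0 : ℂ) (0 : AnisoSchur X H ν α)
    rw [zero_smul, enorm_zero, zero_mul] at this
    rw [this, ENNReal.toReal_zero]
  add_le' A B := by
    rw [← ENNReal.toReal_add (leftMulENorm_ne_top hν A) (leftMulENorm_ne_top hν B)]
    exact ENNReal.toReal_mono
      (ENNReal.add_ne_top.2 ⟨leftMulENorm_ne_top hν A, leftMulENorm_ne_top hν B⟩)
      (leftMulENorm_add_le hν A B)
  neg' A := by
    have := leftMulENorm_smul (-1 : ℂ) A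
    rw [neg_one_smul, enorm_neg, enorm_one, one_mul] at this
    rw [this]
  mul_le' A B := by
    rw [← ENNReal.toReal_mul]
    exact ENNReal.toReal_mono
      (ENNReal.mul_ne_top (leftMulENorm_ne_top hν A) (leftMulENorm_ne_top hν B))
      (leftMulENorm_mul_le hν A B)
  eq_zero_of_map_eq_zero' A h := by
    rw [ENNReal.toReal_eq_zero_iff, or_iff_left (leftMulENorm_ne_top hν A)] at h
    have h1 := schurENorm_le_leftMulENorm hν A
    rw [h, mul_zero, nonpos_iff_eq_zero] at h1
    exact AnisoSchur.ext (eq_zero_of_schurENorm_eq_zero hw.out h1)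
  smul' c A := by
    rw [leftMulENorm_smul, ENNReal.toReal_mul, toReal_enorm]

theorem ofReal_leftMulAlgebraNorm (hν : ∀ x, 0 ≤ ν x) (A : AnisoSchur X H ν α) :
    ENNReal.ofReal (leftMulAlgebraNorm hν A) = A.leftMulENorm :=
  ENNReal.ofReal_toReal (leftMulENorm_ne_top hν A)

theorem exists_leftMulAlgebraNorm_equiv (hν : ∀ x, 0 ≤ ν x) :
    ∃ K : ℝ≥0, ∀ A : AnisoSchur X H ν α,
      leftMulAlgebraNorm hν A ≤ K * ‖A‖ ∧ ‖A‖ ≤ K * leftMulAlgebraNorm hν A := by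
  refine ⟨(Finset.Iic α).card * 2 ^ (∑ j, α j), fun A => ⟨?_, ?_⟩⟩
  · have h := ENNReal.toReal_mono (ENNReal.mul_ne_top (by finiteness) A.finite.ne)
      (leftMulENorm_le hν A)
    rw [ENNReal.toReal_mul, ENNReal.toReal_mul, ENNReal.toReal_pow, ENNReal.toReal_natCast,
      ENNReal.toReal_ofNat] at h
    exact h
  · have h := ENNReal.toReal_mono
      (ENNReal.mul_ne_top (by finiteness) (leftMulENorm_ne_top hν A))
      (schurENorm_le_leftMulENorm hν A)
    rw [ENNReal.toReal_mul, ENNReal.toReal_mul, ENNReal.toReal_pow, ENNReal.toReal_natCast,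
      ENNReal.toReal_ofNat] at h
    exact h

theorem exists_graphENorm_equiv (hν : ∀ x, 0 ≤ ν x) :
    ∃ K : ℝ≥0, ∀ A : AnisoSchur X H ν α,
      graphENorm α ν A.entry ≤ K * schurENorm (anisoWeight α ν) A.entry ∧
      schurENorm (anisoWeight α ν) A.entry ≤ K * graphENorm α ν A.entry := by
  refine ⟨(Finset.Iic α).card + 2 ^ (∑ j, α j), fun A =>
    ⟨(graphENorm_le hν α A.entry).trans ?_, (schurENorm_anisoWeight_le hν α A.entry).trans ?_⟩⟩
  · refine mul_le_mul_left ?_ _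
    push_cast
    exact le_self_add
  · refine mul_le_mul_left ?_ _
    push_cast
    exact le_add_self

end AnisoSchur

/-! ### The main theorem -/

theorem corollary7p5 {d : ℕ} (X : Set (EuclideanSpace ℝ (Fin d))) (hX : IsRelativelySeparated X)
    (H : Type*) [NormedAddCommGroup H] [InnerProductSpace ℂ H] [CompleteSpace H]
    [TopologicalSpace.SeparableSpace H]
    (ν : EuclideanSpace ℝ (Fin d) → ℝ) (hν : IsAdmissibleWeight ν)
    (C δ : ℝ) (hC : 0 < C) (hδ : 0 < δ) (hδ1 : δ ≤ 1)
    (hgrowth : ∀ x, C * (1 + ‖x‖) ^ δ ≤ ν x)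
    (α : Fin d → ℕ) :
    -- a unital Banach *-algebra with isometric involution
    ∃ (_ : NormedRing (AnisoSchur X H ν α)) (_ : NormedAlgebra ℂ (AnisoSchur X H ν α))
      (_ : StarRing (AnisoSchur X H ν α)) (_ : StarModule ℂ (AnisoSchur X H ν α))
      (_ : NormedStarGroup (AnisoSchur X H ν α)) (_ : CompleteSpace (AnisoSchur X H ν α)),
      -- the norm is the anisotropically weighted Schur norm
      (∀ A : AnisoSchur X H ν α, ‖A‖ = (schurENorm (anisoWeight α ν) A.entry).toReal) ∧
      -- the operations are those of matrices
      (∀ (A B : AnisoSchur X H ν α) k l, (A + B).entry k l = A.entry k l + B.entry k l) ∧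
      (∀ (c : ℂ) (A : AnisoSchur X H ν α) k l, (c • A).entry k l = c • A.entry k l) ∧
      (∀ (A B : AnisoSchur X H ν α) k l,
        HasSum (fun n : X => A.entry k n * B.entry n l) ((A * B).entry k l)) ∧
      (∀ k, (1 : AnisoSchur X H ν α).entry k k = 1) ∧
      (∀ k l, k ≠ l → (1 : AnisoSchur X H ν α).entry k l = 0) ∧
      (∀ (A : AnisoSchur X H ν α) k l,
        (star A).entry k l = ContinuousLinearMap.adjoint (A.entry l k)) ∧
      -- solidity
      (∀ (A : AnisoSchur X H ν α) (B : OpMatrix X H), (∀ k l, ‖B k l‖ ≤ ‖A.entry k l‖) →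
        ∃ B' : AnisoSchur X H ν α, B'.entry = B ∧ ‖B'‖ ≤ ‖A‖) ∧
      -- the norm is equivalent to the graph norm of `δ^α`, and the operator norm of left
      -- multiplication with respect to the graph norm is an equivalent algebra norm
      (∃ K : ℝ≥0, ∀ A : AnisoSchur X H ν α,
        graphENorm α ν A.entry ≤ K * schurENorm (anisoWeight α ν) A.entry ∧
        schurENorm (anisoWeight α ν) A.entry ≤ K * graphENorm α ν A.entry) ∧
      (∃ q : AlgebraNorm ℂ (AnisoSchur X H ν α),
        (∀ A : AnisoSchur X H ν α, ENNReal.ofReal (q A) =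
          ⨆ (B : AnisoSchur X H ν α) (_ : graphENorm α ν B.entry = 1),
            graphENorm α ν (A * B).entry) ∧
        ∃ K : ℝ≥0, ∀ A : AnisoSchur X H ν α, q A ≤ K * ‖A‖ ∧ ‖A‖ ≤ K * q A) ∧
      -- the matrices act as bounded operators on `ℓ²(X; H)`, so that the class is a unital
      -- *-subalgebra; it is inverse-closed there, and symmetric
      (∃ φ : AnisoSchur X H ν α →⋆ₐ[ℂ] (EllTwo X H →L[ℂ] EllTwo X H),
        Function.Injective φ ∧
        (∀ (A : AnisoSchur X H ν α) (f : EllTwo X H) (k : X),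
          HasSum (fun l : X => A.entry k l (f l)) (φ A f k)) ∧
        IsInverseClosed φ) ∧
      IsSymmetricStarAlgebra (AnisoSchur X H ν α) := by
  obtain ⟨p, ρ, δ', hp, hδ', hδ'1, hρ, rfl⟩ := hν.exists_growthExponent hC hδ hδ1 hgrowth
  have hν0 : ∀ x, 0 ≤ Real.exp (ρ (p x)) := fun x => (Real.exp_pos _).le
  have : Fact (IsSubmultWeight (anisoWeight α fun x => Real.exp (ρ (p x)))) :=
    ⟨isSubmultWeight_anisoWeight_exp α hρ.concaveOn hρ.map_zero hρ.nonneg⟩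
  obtain ⟨u, K, δ₀, D, hT⟩ := exists_isWeightTruncation hX α hp hδ' hδ'1 hρ
  open AnisoSchur in
  have hclosed : IsInverseClosed
      (AnisoSchur.toOperatorHom (X := X) (H := H) (ν := fun x => Real.exp (ρ (p x))) (α := α)) :=
    isInverseClosed_of_isUnit_one_sub _
      fun A hA => AnisoSchur.isUnit_one_sub_of_norm_toOperator_lt_one hT A hA
  open AnisoSchur in
  refine ⟨inferInstance, inferInstance, inferInstance, inferInstance, inferInstance,
    inferInstance, AnisoSchur.norm_def, fun _ _ _ _ => rfl, fun _ _ _ _ => rfl,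
    AnisoSchur.mul_entry_hasSum, fun k => ?_, fun k l hkl => ?_, AnisoSchur.star_entry,
    AnisoSchur.exists_of_norm_entry_le, AnisoSchur.exists_graphENorm_equiv hν0,
    ⟨AnisoSchur.leftMulAlgebraNorm hν0, AnisoSchur.ofReal_leftMulAlgebraNorm hν0,
      AnisoSchur.exists_leftMulAlgebraNorm_equiv hν0⟩,
    ⟨AnisoSchur.toOperatorHom, AnisoSchur.toOperator_injective, AnisoSchur.toOperator_hasSum,
      hclosed⟩,
    isSymmetricStarAlgebra_of_isInverseClosed AnisoSchur.toOperator_injective hclosed⟩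
  · rw [AnisoSchur.one_entry, if_pos rfl]
  · rw [AnisoSchur.one_entry, if_neg hkl]
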